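/- Let $\mathcal F=\bigoplus_{n\ge 0}L^2_{\rm sym}((\mathbb R^3)^n)$ be the bosonic Fock space in momentum representation. Put $\hat v(\xi)=\frac{1}{4\pi|\xi|}$ (which is not in $L^2(\mathbb R^3)$), fix $P\in\mathbb R^3$ and $\alpha>0$, and let $H_0=(P-P_f)^2+N+1$, i.e. multiplication by $(P-\sum_{j=1}^n k_j)^2+n+1$ on the $n$-particle component, with its maximal domain $D(H_0)$. Let $$(a(v)\Psi)^{(n)}(k_1,\dots,k_n)=\sqrt{n+1}\int_{\mathbb R^3}\hat v(\xi)\,\Psi^{(n+1)}(\xi,k_1,\dots,k_n)\,d\xi ,$$ $$(a^*(v)\Psi)^{(n)}(k_1,\dots,k_n)=\frac1{\sqrt n}\sum_{j=1}^n\hat v(k_j)\,\Psi^{(n-1)}(k_1,\dots,k_{j-1},k_{j+1},\dots,k_n),\qquad (a^*(v)\Psi)^{(0)}=0 .$$ The function $a^*(v)\Psi$ is in general not in $\mathcal F$; $H_0^{-1}a^*(v)\Psi$ denotes its quotient by the function defining $H_0$. Consider the quadratic form $$Q_P(\Psi)=\|H_0^{1/2}\Psi\|^2+2\sqrt\alpha\,\operatorname{Re}\langle\Psi,a(v)\Psi\rangle,\qquad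 \Psi\in D(H_0^{1/2}),$$ where $\langle\Psi,a(v)\Psi\rangle=\sum_n\langle\Psi^{(n)},(a(v)\Psi)^{(n)}\rangle$; this is the form of the formal expression $H(P)+1=(P-P_f)^2+N+\sqrt\alpha\,(a(v)+a^*(v))+1$. Then $Q_P$ is well defined on $D(H_0^{1/2})$ (for every $\Psi$ in this domain the integrals defining $a(v)\Psi$ converge absolutely almost everywhere, each $(a(v)\Psi)^{(n)}$ is in $L^2$, and the series converges absolutely), the operators $a(v)H_0^{-1}$ and $H_0^{-1}a^*(v)$ are defined on all of $\mathcal F$, and the operator $$H(P)+1:=K(P)+T(P),\quad K(P)=(1+\sqrt\alpha\,a(v)H_0^{-1})\,H_0\,(1+\sqrt\alpha\,H_0^{-1}a^*(v)),\quad T(P)=-\alpha\,a(v)H_0^{-1}a^*(v),$$ on its natural domain, has the domain $$D(H(P))=\{\Psi\in\mathcal F : (1+\sqrt\alpha\,H_0^{-1}a^*(v))\Psi\in D(H_0)\},$$ is self-adjoint, and $Q_P$ is its form: $Q_P$ is bounded below and closed on $D(H_0^{1/2})$, $D(H(P))\subset D(H_0^{1/2})$ is a form core for $Q_P$, and $Q_P(\Psi)=\langle\Psi,(H(P)+1)\Psi\rangle$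 for all $\Psi\in D(H(P))$. -/

import Mathlib

open MeasureTheory Filter Topology

noncomputable section

namespace Froehlich

/-! ### Bosonic Fock space over `L²(ℝ³)`, in momentum representation -/

/-- Momentum space `ℝ³`. -/
abbrev R3 : Type := EuclideanSpace ℝ (Fin 3)

/-- The `n`-particle space `L²((ℝ³)ⁿ)` (for `n = 0`: functions on a point, i.e. `ℂ`). -/
abbrev L2n (n : ℕ) : Type := Lp ℂ 2 (volume : Measure (Fin n → R3))

theorem measurePreserving_perm {n : ℕ} (σ : Equiv.Perm (Fin n)) :
    MeasurePreserving (fun k : Fin n → R3 => k ∘ σ) volume volume := by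
  have h := volume_measurePreserving_piCongrLeft (fun _ : Fin n => R3) σ.symm
  have he : (fun k : Fin n → R3 => k ∘ σ)
      = ⇑(MeasurableEquiv.piCongrLeft (fun _ : Fin n => R3) σ.symm) := by
    funext k i
    have := MeasurableEquiv.piCongrLeft_apply_apply (β := fun _ : Fin n => R3) σ.symm k (σ i)
    simpa using this.symm
  rw [he]
  exact h

/-- The action `f ↦ ((k₁, …, kₙ) ↦ f (k_{σ 1}, …, k_{σ n}))` of a permutation on `L²((ℝ³)ⁿ)`. -/
def permAct {n : ℕ} (σ : Equiv.Perm (Fin n)) : L2n n →ₗᵢ[ℂ] L2n n :=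
  Lp.compMeasurePreservingₗᵢ ℂ (fun k : Fin n → R3 => k ∘ σ) (measurePreserving_perm σ)

/-- The symmetric `n`-particle space `L²_sym((ℝ³)ⁿ)`. -/
def bosons (n : ℕ) : Submodule ℂ (L2n n) where
  carrier := {f | ∀ σ : Equiv.Perm (Fin n), permAct σ f = f}
  zero_mem' := fun σ => map_zero _
  add_mem' := fun {f g} hf hg σ => by rw [map_add, hf σ, hg σ]
  smul_mem' := fun c f hf σ => by rw [map_smul, hf σ]

theorem isClosed_bosons (n : ℕ) : IsClosed (bosons n : Set (L2n n)) := by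
  have : (bosons n : Set (L2n n)) = ⋂ σ : Equiv.Perm (Fin n), {f | permAct σ f = f} := by
    ext f
    simp [bosons]
  rw [this]
  exact isClosed_iInter fun σ => isClosed_eq (permAct σ).continuous continuous_id

instance completeSpace_bosons (n : ℕ) : CompleteSpace (bosons n) :=
  (isClosed_bosons n).completeSpace_coe

/-- The bosonic Fock space `⨁ₙ L²_sym((ℝ³)ⁿ)` (Hilbert sum). -/
abbrev Fock : Type := lp (fun n : ℕ => bosons n) 2

/-- The `n`-particle component `Ψ⁽ⁿ⁾` as a function of the `n` momenta (defined a.e.). -/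
def comp (Ψ : Fock) (n : ℕ) : (Fin n → R3) → ℂ := ⇑((Ψ n : bosons n) : L2n n)

theorem comp_add (Ψ Φ : Fock) (n : ℕ) : comp (Ψ + Φ) n =ᵐ[volume] comp Ψ n + comp Φ n :=
  Lp.coeFn_add ((Ψ n : bosons n) : L2n n) ((Φ n : bosons n) : L2n n)

theorem comp_smul (c : ℂ) (Ψ : Fock) (n : ℕ) : comp (c • Ψ) n =ᵐ[volume] c • comp Ψ n :=
  Lp.coeFn_smul c ((Ψ n : bosons n) : L2n n)

theorem comp_zero (n : ℕ) : comp (0 : Fock) n =ᵐ[volume] 0 :=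
  Lp.coeFn_zero ℂ 2 (volume : Measure (Fin n → R3))

theorem eq_zero_of_comp {Ψ : Fock} (h : ∀ n, comp Ψ n =ᵐ[volume] 0) : Ψ = 0 := by
  ext1
  funext n
  apply Subtype.ext
  apply Lp.ext
  exact (h n).trans (comp_zero n).symm

/-! ### Unbounded operators -/

/-- The composition `g ∘ f` of unbounded operators on its natural domain
`{x ∈ D(f) | f x ∈ D(g)}`. -/
def pcomp {E : Type*} [AddCommGroup E] [Module ℂ E] (g f : E →ₗ.[ℂ] E) : E →ₗ.[ℂ] E where
  domain := (g.domain.comap f.toFun).map f.domain.subtype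
  toFun :=
    { toFun := fun x => g ⟨f ⟨x, by obtain ⟨y, -, hy⟩ := x.2; rw [← hy]; exact y.2⟩, by
        obtain ⟨y, hy, hyx⟩ := x.2
        have : (⟨x, by rw [← hyx]; exact y.2⟩ : f.domain) = y := Subtype.ext hyx.symm
        rw [this]; exact hy⟩
      map_add' := fun x y => by
        rw [← LinearPMap.map_add]; congr 1; apply Subtype.ext
        exact LinearPMap.map_add f ⟨x, _⟩ ⟨y, _⟩
      map_smul' := fun c x => by
        rw [RingHom.id_apply, ← LinearPMap.map_smul]; congr 1; apply Subtype.ext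
        exact LinearPMap.map_smul f c ⟨x, _⟩ }

theorem mem_pcomp_domain {E : Type*} [AddCommGroup E] [Module ℂ E] (g f : E →ₗ.[ℂ] E) (x : E) :
    x ∈ (pcomp g f).domain ↔ ∃ hx : x ∈ f.domain, f ⟨x, hx⟩ ∈ g.domain := by
  constructor
  · rintro ⟨y, hy, rfl⟩
    exact ⟨y.2, hy⟩
  · rintro ⟨hx, h⟩
    exact ⟨⟨x, hx⟩, h, rfl⟩

/-- The identity as an everywhere defined operator. -/
def pone {E : Type*} [AddCommGroup E] [Module ℂ E] : E →ₗ.[ℂ] E := LinearMap.id.toPMap ⊤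

/-- A quadratic form `q` with form domain `D` is the form of the operator `A`: `A` is self-adjoint,
`q` is bounded below and extends `Ψ ↦ ⟪Ψ, A Ψ⟫` from `D(A)` to `D`, `q` is closed on `D`, and `D(A)`
is a form core. That is, `q` is the closure of the quadratic form of the semibounded self-adjoint
operator `A`. -/
structure IsFormOf {E : Type*} [NormedAddCommGroup E] [InnerProductSpace ℂ E] [CompleteSpace E]
    (D : Submodule ℂ E) (q : D → ℝ) (A : E →ₗ.[ℂ] E) : Prop where
  selfAdjoint : IsSelfAdjoint A
  bounded_below : ∃ m : ℝ, ∀ Ψ : D, m * ‖Ψ‖ ^ 2 ≤ q Ψ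
  domain_le : A.domain ≤ D
  eq_inner : ∀ Ψ : A.domain, (q ⟨Ψ, domain_le Ψ.2⟩ : ℂ) = inner ℂ (Ψ : E) (A Ψ)
  closed : ∀ (u : ℕ → D) (Ψ : E), Tendsto (fun j => (u j : E)) atTop (𝓝 Ψ) →
    Tendsto (fun p : ℕ × ℕ => q (u p.1 - u p.2)) atTop (𝓝 0) →
    ∃ hΨ : Ψ ∈ D, Tendsto (fun j => q (u j - ⟨Ψ, hΨ⟩)) atTop (𝓝 0)
  core : ∀ Ψ : D, ∃ u : ℕ → D, (∀ j, (u j : E) ∈ A.domain) ∧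
    Tendsto (fun j => (u j : E)) atTop (𝓝 (Ψ : E)) ∧
    Tendsto (fun j => q (u j - Ψ)) atTop (𝓝 0)

/-! ### Multiplication operators in the momenta -/

/-- The graph of multiplication by the functions `w n` of the momenta: all `(Ψ, Φ)` with
`Φ⁽ⁿ⁾ = w n · Ψ⁽ⁿ⁾` for all `n`. -/
def multGraph (w : ∀ n : ℕ, (Fin n → R3) → ℝ) : Submodule ℂ (Fock × Fock) where
  carrier := {p | ∀ n, ∀ᵐ k, comp p.2 n k = (w n k : ℂ) * comp p.1 n k}
  zero_mem' := fun n => by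
    filter_upwards [comp_zero n] with k hk
    simp [hk]
  add_mem' := fun {p q} hp hq n => by
    filter_upwards [hp n, hq n, comp_add p.1 q.1 n, comp_add p.2 q.2 n] with k h1 h2 h3 h4
    simp only [Prod.fst_add, Prod.snd_add, h3, h4, Pi.add_apply, h1, h2]
    ring
  smul_mem' := fun c p hp n => by
    filter_upwards [hp n, comp_smul c p.1 n, comp_smul c p.2 n] with k h1 h3 h4
    simp only [Prod.smul_fst, Prod.smul_snd, h3, h4, Pi.smul_apply, h1, smul_eq_mul]
    ring

theorem multGraph_singleValued (w : ∀ n : ℕ, (Fin n → R3) → ℝ) :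
    ∀ p ∈ multGraph w, p.1 = 0 → p.2 = 0 := by
  rintro ⟨Ψ, Φ⟩ hp rfl
  refine eq_zero_of_comp fun n => ?_
  filter_upwards [hp n, comp_zero n] with k h1 h2
  rw [h1, h2]
  simp

/-- The (maximal) operator of multiplication by the functions `w n` of the momenta. -/
def multOp (w : ∀ n : ℕ, (Fin n → R3) → ℝ) : Fock →ₗ.[ℂ] Fock := (multGraph w).toLinearPMap

/-- The function `(P - ∑ⱼ kⱼ)² + n + 1`. -/
def energy (P : R3) (n : ℕ) (k : Fin n → R3) : ℝ := ‖P - ∑ j, k j‖ ^ 2 + n + 1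

/-- `H₀ = (P - P_f)² + N + 1`. -/
def H0 (P : R3) : Fock →ₗ.[ℂ] Fock := multOp (energy P)

/-- `H₀^{1/2}`. -/
def H0sqrt (P : R3) : Fock →ₗ.[ℂ] Fock := multOp fun n k => √(energy P n k)

/-- `H₀⁻¹`. -/
def H0inv (P : R3) : Fock →ₗ.[ℂ] Fock := multOp fun n k => (energy P n k)⁻¹

/-! ### Annihilation and creation -/

/-- The form factor `v̂(ξ) = 1 / (4π|ξ|)` in momentum space, which is not in `L²`. -/
def vhat (ξ : R3) : ℝ := 1 / (4 * Real.pi * ‖ξ‖)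

/-- `(a(v)Ψ)⁽ⁿ⁾(k) = √(n+1) ∫ v̂(ξ) Ψ⁽ⁿ⁺¹⁾(ξ, k) dξ`. -/
def annih (Ψ : Fock) (n : ℕ) (k : Fin n → R3) : ℂ :=
  (√(n + 1) : ℝ) * ∫ ξ : R3, (vhat ξ : ℂ) * comp Ψ (n + 1) (Fin.cons ξ k)

/-- The integrals that define `a(v)Ψ` converge absolutely for almost all momenta. -/
def AnnihConv (Ψ : Fock) : Prop :=
  ∀ n : ℕ, ∀ᵐ k : Fin n → R3,
    Integrable fun ξ : R3 => (vhat ξ : ℂ) * comp Ψ (n + 1) (Fin.cons ξ k)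

/-- The measurable function (in general not in `L²`)
`(a*(v)Ψ)⁽ⁿ⁾(k₁, …, kₙ) = n^{-1/2} ∑ⱼ v̂(kⱼ) Ψ⁽ⁿ⁻¹⁾(k₁, …, kⱼ₋₁, kⱼ₊₁, …, kₙ)`. -/
def creat (Ψ : Fock) : ∀ n : ℕ, (Fin n → R3) → ℂ
  | 0, _ => 0
  | n + 1, k => ((√(n + 1))⁻¹ : ℝ) *
      ∑ j : Fin (n + 1), (vhat (k j) : ℂ) * comp Ψ n (fun i => k (j.succAbove i))

theorem ae_succAbove {n : ℕ} (j : Fin (n + 1)) {p : (Fin n → R3) → Prop} (h : ∀ᵐ k, p k) :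
    ∀ᵐ k : Fin (n + 1) → R3, p (fun i => k (j.succAbove i)) := by
  have h1 := volume_preserving_piFinSuccAbove (fun _ : Fin (n + 1) => R3) j
  have h2 : ∀ᵐ z : R3 × (Fin n → R3), p z.2 := Measure.quasiMeasurePreserving_snd.ae h
  exact h1.quasiMeasurePreserving.ae h2

theorem ae_cons {n : ℕ} {p : (Fin (n + 1) → R3) → Prop} (h : ∀ᵐ k, p k) :
    ∀ᵐ k : Fin n → R3, ∀ᵐ ξ : R3, p (Fin.cons ξ k) := by
  have h1 := (volume_preserving_piFinSuccAbove (fun _ : Fin (n + 1) => R3) 0).symm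
  have h2 := h1.quasiMeasurePreserving.ae h
  have h3 : ∀ᵐ z : (Fin n → R3) × R3, p (Fin.cons z.2 z.1) := by
    have := (Measure.measurePreserving_swap (μ := (volume : Measure (Fin n → R3)))
      (ν := (volume : Measure R3))).quasiMeasurePreserving.ae h2
    rw [← Measure.volume_eq_prod] at this
    simpa [MeasurableEquiv.piFinSuccAbove, Fin.insertNthEquiv] using this
  exact Measure.ae_ae_of_ae_prod h3

theorem creat_add (Ψ Φ : Fock) (n : ℕ) : creat (Ψ + Φ) n =ᵐ[volume] creat Ψ n + creat Φ n := by
  cases n with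
  | zero => exact Eventually.of_forall fun k => by simp [creat]
  | succ n =>
    have := ae_all_iff.2 fun j : Fin (n + 1) => ae_succAbove j (comp_add Ψ Φ n)
    filter_upwards [this] with k hk
    simp only [creat, Pi.add_apply, hk, mul_add, Finset.sum_add_distrib]

theorem creat_smul (c : ℂ) (Ψ : Fock) (n : ℕ) : creat (c • Ψ) n =ᵐ[volume] c • creat Ψ n := by
  cases n with
  | zero => exact Eventually.of_forall fun k => by simp [creat]
  | succ n =>
    have := ae_all_iff.2 fun j : Fin (n + 1) => ae_succAbove j (comp_smul c Ψ n)
    filter_upwards [this] with k hk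
    simp only [creat, Pi.smul_apply, hk, smul_eq_mul, Finset.mul_sum]
    exact Finset.sum_congr rfl fun j _ => by ring

theorem annihIntegrand_add (Ψ Φ : Fock) (n : ℕ) : ∀ᵐ k : Fin n → R3, ∀ᵐ ξ : R3,
    (vhat ξ : ℂ) * comp (Ψ + Φ) (n + 1) (Fin.cons ξ k)
      = (vhat ξ : ℂ) * comp Ψ (n + 1) (Fin.cons ξ k)
        + (vhat ξ : ℂ) * comp Φ (n + 1) (Fin.cons ξ k) := by
  filter_upwards [ae_cons (comp_add Ψ Φ (n + 1))] with k hk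
  filter_upwards [hk] with ξ h
  rw [h, Pi.add_apply, mul_add]

theorem annihIntegrand_smul (c : ℂ) (Ψ : Fock) (n : ℕ) : ∀ᵐ k : Fin n → R3, ∀ᵐ ξ : R3,
    (vhat ξ : ℂ) * comp (c • Ψ) (n + 1) (Fin.cons ξ k)
      = c * ((vhat ξ : ℂ) * comp Ψ (n + 1) (Fin.cons ξ k)) := by
  filter_upwards [ae_cons (comp_smul c Ψ (n + 1))] with k hk
  filter_upwards [hk] with ξ h
  rw [h, Pi.smul_apply, smul_eq_mul]
  ring

theorem annihIntegrand_zero (n : ℕ) : ∀ᵐ k : Fin n → R3, ∀ᵐ ξ : R3,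
    (vhat ξ : ℂ) * comp (0 : Fock) (n + 1) (Fin.cons ξ k) = 0 := by
  filter_upwards [ae_cons (comp_zero (n + 1))] with k hk
  filter_upwards [hk] with ξ h
  rw [h, Pi.zero_apply, mul_zero]

theorem annih_zero (n : ℕ) : annih 0 n =ᵐ[volume] 0 := by
  filter_upwards [annihIntegrand_zero n] with k hk
  simp only [annih, integral_congr_ae hk, integral_zero, mul_zero, Pi.zero_apply]

/-- The graph of `a(v)`: all `(Ψ, Φ)` for which the integrals defining `a(v)Ψ` converge absolutely
and `Φ⁽ⁿ⁾ = (a(v)Ψ)⁽ⁿ⁾` for all `n`. -/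
def annihGraph : Submodule ℂ (Fock × Fock) where
  carrier := {p | AnnihConv p.1 ∧ ∀ n, ∀ᵐ k, comp p.2 n k = annih p.1 n k}
  zero_mem' := by
    refine ⟨fun n => ?_, fun n => ?_⟩
    · filter_upwards [annihIntegrand_zero n] with k hk
      exact (integrable_zero R3 ℂ volume).congr (hk.mono fun ξ h => h.symm)
    · filter_upwards [comp_zero n, annih_zero n] with k h1 h2
      exact h1.trans h2.symm
  add_mem' := fun {p q} hp hq => by
    refine ⟨fun n => ?_, fun n => ?_⟩
    · filter_upwards [annihIntegrand_add p.1 q.1 n, hp.1 n, hq.1 n] with k hk h1 h2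
      exact (h1.add h2).congr (hk.mono fun ξ h => h.symm)
    · filter_upwards [annihIntegrand_add p.1 q.1 n, hp.1 n, hq.1 n, hp.2 n, hq.2 n,
        comp_add p.2 q.2 n] with k hk h1 h2 h3 h4 h5
      simp only [Prod.snd_add, Prod.fst_add, h5, Pi.add_apply, h3, h4, annih]
      rw [integral_congr_ae hk, integral_add h1 h2, mul_add]
  smul_mem' := fun c p hp => by
    refine ⟨fun n => ?_, fun n => ?_⟩
    · filter_upwards [annihIntegrand_smul c p.1 n, hp.1 n] with k hk h1
      exact (h1.const_mul c).congr (hk.mono fun ξ h => h.symm)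
    · filter_upwards [annihIntegrand_smul c p.1 n, hp.2 n, comp_smul c p.2 n] with k hk h3 h5
      simp only [Prod.smul_snd, Prod.smul_fst, h5, Pi.smul_apply, h3, annih, smul_eq_mul]
      rw [integral_congr_ae hk, integral_const_mul]
      ring

theorem annihGraph_singleValued : ∀ p ∈ annihGraph, p.1 = 0 → p.2 = 0 := by
  rintro ⟨Ψ, Φ⟩ hp rfl
  refine eq_zero_of_comp fun n => ?_
  filter_upwards [hp.2 n, annih_zero n] with k h1 h2
  exact h1.trans h2

/-- The annihilation operator `a(v)` on its natural domain. -/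
def annihOp : Fock →ₗ.[ℂ] Fock := annihGraph.toLinearPMap

/-- The graph of `H₀⁻¹a*(v)`: all `(Ψ, Φ)` with
`Φ⁽ⁿ⁾ = ((P - ∑ⱼ kⱼ)² + n + 1)⁻¹ (a*(v)Ψ)⁽ⁿ⁾` for all `n`. -/
def H0invCreatGraph (P : R3) : Submodule ℂ (Fock × Fock) where
  carrier := {p | ∀ n, ∀ᵐ k, comp p.2 n k = ((energy P n k)⁻¹ : ℝ) * creat p.1 n k}
  zero_mem' := fun n => by
    filter_upwards [comp_zero n, creat_smul 0 0 n] with k h1 h2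
    rw [zero_smul] at h2
    change comp (0 : Fock) n k = _ * creat (0 : Fock) n k
    rw [h1, h2]
    simp
  add_mem' := fun {p q} hp hq n => by
    filter_upwards [hp n, hq n, creat_add p.1 q.1 n, comp_add p.2 q.2 n] with k h1 h2 h3 h4
    simp only [Prod.fst_add, Prod.snd_add, h3, h4, Pi.add_apply, h1, h2]
    ring
  smul_mem' := fun c p hp n => by
    filter_upwards [hp n, creat_smul c p.1 n, comp_smul c p.2 n] with k h1 h3 h4
    simp only [Prod.smul_fst, Prod.smul_snd, h3, h4, Pi.smul_apply, h1, smul_eq_mul]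
    ring

theorem H0invCreatGraph_singleValued (P : R3) :
    ∀ p ∈ H0invCreatGraph P, p.1 = 0 → p.2 = 0 := by
  rintro ⟨Ψ, Φ⟩ hp rfl
  refine eq_zero_of_comp fun n => ?_
  filter_upwards [hp n, creat_smul 0 0 n] with k h1 h2
  rw [zero_smul] at h2
  rw [h1, h2]
  simp

/-- The operator `H₀⁻¹a*(v)` on its natural domain. -/
def H0invCreat (P : R3) : Fock →ₗ.[ℂ] Fock := (H0invCreatGraph P).toLinearPMap

/-! ### The Fröhlich Hamiltonian at fixed total momentum -/

/-- `1 + √α a(v)H₀⁻¹`. -/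
def leftFactor (α : ℝ) (P : R3) : Fock →ₗ.[ℂ] Fock :=
  pone + ((√α : ℝ) : ℂ) • pcomp annihOp (H0inv P)

/-- `1 + √α H₀⁻¹a*(v)`. -/
def rightFactor (α : ℝ) (P : R3) : Fock →ₗ.[ℂ] Fock :=
  pone + ((√α : ℝ) : ℂ) • H0invCreat P

/-- `K(P) = (1 + √α a(v)H₀⁻¹) H₀ (1 + √α H₀⁻¹a*(v))` on its natural domain. -/
def K (α : ℝ) (P : R3) : Fock →ₗ.[ℂ] Fock :=
  pcomp (leftFactor α P) (pcomp (H0 P) (rightFactor α P))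

/-- `T(P) = -α a(v)H₀⁻¹a*(v)` on its natural domain. -/
def T (α : ℝ) (P : R3) : Fock →ₗ.[ℂ] Fock :=
  -((α : ℂ) • pcomp annihOp (H0invCreat P))

/-- The form domain `D(H₀^{1/2})`. -/
def formDomain (P : R3) : Submodule ℂ Fock := (H0sqrt P).domain

/-- The term `⟪Ψ⁽ⁿ⁾, (a(v)Ψ)⁽ⁿ⁾⟫` of `⟪Ψ, a(v)Ψ⟫`. -/
def interactionTerm (Ψ : Fock) (n : ℕ) : ℂ :=
  ∫ k : Fin n → R3, (starRingEnd ℂ) (comp Ψ n k) * annih Ψ n k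

/-- The quadratic form `Q_P(Ψ) = ‖H₀^{1/2}Ψ‖² + 2√α Re ⟪Ψ, a(v)Ψ⟫` on `D(H₀^{1/2})`. -/
def Q (α : ℝ) (P : R3) (Ψ : formDomain P) : ℝ :=
  ‖H0sqrt P Ψ‖ ^ 2 + 2 * √α * (∑' n, interactionTerm (Ψ : Fock) n).re

end Froehlich

end

/-!
Although `v̂` is not square integrable, `a(v)H₀^{-1/2}` is bounded on each component, because
`∫ v̂(ξ)² ((p - ξ)² + m)⁻¹ dξ ≤ (4√m)⁻¹` uniformly in `p`. Its norm grows only like `n^{1/4}`,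
whereas `‖H₀^{-1/2}‖ ≤ (n + 1)^{-1/2}`, so the products `S = H₀^{-1/2}`, `F = a(v)H₀⁻¹`,
`G = H₀^{-1/2}a(v)H₀^{-1/2}`, `V = a(v)H₀⁻¹a(v)H₀^{-1/2}` and `W = a(v)H₀⁻¹a*(v)H₀^{-1/2}` are
bounded on Fock space.

If `(1 + √α H₀⁻¹a*(v))Ψ ∈ D(H₀)`, then `Ψ = S g` for some `g`, and with this substitution
`K(P) + T(P)` becomes `S⁻¹LS⁻¹` with `L = 1 + √α (G + G*)` bounded and self-adjoint, while `Q_P(Ψ)`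
becomes `⟪g, L g⟫`. Since `‖G*g‖² = ⟪S g, W g⟫ ≤ ‖W‖ ‖S g‖ ‖g‖`, the operator `L + λS²` is coercive
for large `λ`, hence invertible: this gives surjectivity of `K(P) + T(P) + λ`, so self-adjointness,
and makes the form norm of `Ψ` equivalent to `‖g‖`, so `Q_P` is closed with core `D(H(P))`.
-/

noncomputable section

namespace Froehlich

/-! ### Self-adjoint operators and their forms -/

section SelfAdjoint

variable {E : Type*} [NormedAddCommGroup E] [InnerProductSpace ℂ E]

theorem inner_add_ofReal_smul_left_eq_right {A : E →ₗ.[ℂ] E} (hA : A.IsFormalAdjoint A) (lam : ℝ)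
    (x y : A.domain) :
    inner ℂ (A x + (lam : ℂ) • (x : E)) (y : E) = inner ℂ (x : E) (A y + (lam : ℂ) • (y : E)) := by
  rw [inner_add_left, inner_add_right, hA x y, inner_smul_left, inner_smul_right,
    Complex.conj_ofReal]

theorem tendsto_re_inner_sub (L : E →L[ℂ] E) {g : ℕ → E} {f : E} (hg : Tendsto g atTop (𝓝 f)) :
    Tendsto (fun j => (inner ℂ (g j - f) (L (g j - f))).re) atTop (𝓝 0) := by
  have hcont : Continuous fun g => (inner ℂ g (L g)).re := by fun_prop
  have hsub : Tendsto (fun j => g j - f) atTop (𝓝 0) := by simpa using hg.sub_const f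
  have hzero := hcont.tendsto 0
  rw [inner_zero_left, Complex.zero_re] at hzero
  exact hzero.comp hsub

variable [CompleteSpace E]

theorem dense_domain_of_surjective_add_smul {A : E →ₗ.[ℂ] E} (hA : A.IsFormalAdjoint A) {lam : ℝ}
    (hsurj : ∀ η : E, ∃ x : A.domain, A x + (lam : ℂ) • (x : E) = η) :
    Dense (A.domain : Set E) := by
  rw [Submodule.dense_iff_topologicalClosure_eq_top, Submodule.topologicalClosure_eq_top_iff,
    Submodule.eq_bot_iff]
  intro x hx
  obtain ⟨y, rfl⟩ := hsurj x
  obtain ⟨z, hz⟩ := hsurj y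
  have hy := Submodule.inner_left_of_mem_orthogonal z.2 hx
  rw [inner_add_ofReal_smul_left_eq_right hA, hz, inner_self_eq_zero, Submodule.coe_eq_zero] at hy
  simp [hy]

theorem isSelfAdjoint_of_surjective_add_smul {A : E →ₗ.[ℂ] E} (hA : A.IsFormalAdjoint A) {lam : ℝ}
    (hsurj : ∀ η : E, ∃ x : A.domain, A x + (lam : ℂ) • (x : E) = η) : IsSelfAdjoint A := by
  have hdense := dense_domain_of_surjective_add_smul hA hsurj
  have mem_domain : ∀ y : A.adjoint.domain, (y : E) ∈ A.domain := by
    intro y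
    obtain ⟨w, hw⟩ := hsurj (A.adjoint y + (lam : ℂ) • (y : E))
    have orthogonal : ∀ z : A.domain,
        inner ℂ ((y : E) - w) (A z + (lam : ℂ) • (z : E)) = 0 := by
      intro z
      rw [inner_sub_left, ← inner_add_ofReal_smul_left_eq_right hA, hw, inner_add_left,
        inner_add_right, inner_smul_left, inner_smul_right, Complex.conj_ofReal,
        A.adjoint_isFormalAdjoint hdense y z, sub_self]
    obtain ⟨z, hz⟩ := hsurj (y - w)
    have hyw := orthogonal z
    rw [hz, inner_self_eq_zero, sub_eq_zero] at hyw
    exact hyw ▸ w.2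
  rw [LinearPMap.isSelfAdjoint_def]
  have adjoint_le : A.adjoint ≤ A := by
    refine ⟨fun y hy => mem_domain ⟨y, hy⟩, fun x y hxy => ?_⟩
    exact LinearPMap.adjoint_apply_eq hdense x fun z => by rw [hA y z, hxy]
  exact le_antisymm adjoint_le (hA.le_adjoint hdense)

theorem denseRange_of_isSelfAdjoint {S : E →L[ℂ] E} (hS : IsSelfAdjoint S)
    (hinj : Function.Injective S) : DenseRange S := by
  have : Dense (S.range : Set E) := by
    rw [Submodule.dense_iff_topologicalClosure_eq_top, Submodule.topologicalClosure_eq_top_iff,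
      ContinuousLinearMap.orthogonal_range, hS.adjoint_eq]
    exact LinearMap.ker_eq_bot.2 hinj
  exact this

/-- `A` is the operator formally given by `S⁻¹LS⁻¹`. Its graph is described through the bounded
operators `S` and `L` only, so that no domain has to be prescribed. -/
structure IsInverseSandwich (S L : E →L[ℂ] E) (A : E →ₗ.[ℂ] E) : Prop where
  isSelfAdjoint_outer : IsSelfAdjoint S
  injective_outer : Function.Injective S
  isSelfAdjoint_inner : IsSelfAdjoint L
  mem_graph_iff : ∀ Ψ η, (Ψ, η) ∈ A.graph ↔ ∃ g, S g = Ψ ∧ L g = S η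

theorem exists_continuousLinearEquiv_of_coercive {S L : E →L[ℂ] E} (hS : IsSelfAdjoint S)
    {lam c : ℝ} (hc : 0 < c)
    (hcoer : ∀ g, c * ‖g‖ ^ 2 ≤ (inner ℂ g (L g)).re + lam * ‖S g‖ ^ 2) :
    ∃ M : E ≃L[ℂ] E, ∀ g, M g = L g + (lam : ℂ) • S (S g) := by
  have re_inner : ∀ g, (inner ℂ g ((L + (lam : ℂ) • S ∘L S) g)).re
      = (inner ℂ g (L g)).re + lam * ‖S g‖ ^ 2 := by
    intro g
    have hsq : inner ℂ g (S (S g)) = ((‖S g‖ ^ 2 : ℝ) : ℂ) := by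
      rw [← hS.isSymmetric.apply_clm, inner_self_eq_norm_sq_to_K]
      norm_cast
    simp only [add_apply, smul_apply, ContinuousLinearMap.comp_apply]
    rw [inner_add_right, inner_smul_right, hsq, Complex.add_re, Complex.re_ofReal_mul,
      Complex.ofReal_re]
  have hunit : IsUnit (L + (lam : ℂ) • S ∘L S) := by
    refine ContinuousLinearMap.isUnit_of_forall_le_norm_inner_map _ (c := ⟨c, hc.le⟩) hc fun g => ?_
    calc ‖g‖ ^ 2 * c ≤ (inner ℂ g ((L + (lam : ℂ) • S ∘L S) g)).re := by
          rw [re_inner, mul_comm]; exact hcoer g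
      _ ≤ ‖inner ℂ g ((L + (lam : ℂ) • S ∘L S) g)‖ := Complex.re_le_norm _
      _ = ‖inner ℂ ((L + (lam : ℂ) • S ∘L S) g) g‖ := norm_inner_symm _ _
  obtain ⟨u, hu⟩ := hunit
  refine ⟨ContinuousLinearEquiv.unitsEquiv ℂ E u, fun g => ?_⟩
  rw [ContinuousLinearEquiv.unitsEquiv_apply, hu]
  rfl

theorem exists_tendsto_of_coercive {S L : E →L[ℂ] E} {lam c : ℝ} (hc : 0 < c)
    (hcoer : ∀ g, c * ‖g‖ ^ 2 ≤ (inner ℂ g (L g)).re + lam * ‖S g‖ ^ 2) {g : ℕ → E} {Ψ : E}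
    (hSg : Tendsto (fun j => S (g j)) atTop (𝓝 Ψ))
    (hLg : Tendsto (fun p : ℕ × ℕ => (inner ℂ (g p.1 - g p.2) (L (g p.1 - g p.2))).re)
      atTop (𝓝 0)) :
    ∃ f, Tendsto g atTop (𝓝 f) := by
  have hS_sub : Tendsto (fun p : ℕ × ℕ => S (g p.1 - g p.2)) atTop (𝓝 0) := by
    simp only [map_sub]
    rw [← prod_atTop_atTop_eq, ← sub_self Ψ]
    exact (hSg.comp tendsto_fst).sub (hSg.comp tendsto_snd)
  have hbound : Tendsto (fun p : ℕ × ℕ => c⁻¹ * ((inner ℂ (g p.1 - g p.2) (L (g p.1 - g p.2))).re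
      + lam * ‖S (g p.1 - g p.2)‖ ^ 2)) atTop (𝓝 0) := by
    simpa using (hLg.add ((hS_sub.norm.pow 2).const_mul lam)).const_mul c⁻¹
  have hsq : Tendsto (fun p : ℕ × ℕ => ‖g p.1 - g p.2‖ ^ 2) atTop (𝓝 0) := by
    refine squeeze_zero (fun p => by positivity) (fun p => ?_) hbound
    rw [inv_mul_eq_div, le_div_iff₀ hc, mul_comm]
    exact hcoer _
  refine cauchySeq_tendsto_of_complete (cauchySeq_iff_tendsto_dist_atTop_0.2 ?_)
  simpa [Real.sqrt_sq, dist_eq_norm] using hsq.sqrt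

namespace IsInverseSandwich

variable {S L : E →L[ℂ] E} {A : E →ₗ.[ℂ] E} (h : IsInverseSandwich S L A)
include h

theorem exists_preimage (x : A.domain) : ∃ g, S g = x ∧ L g = S (A x) :=
  (h.mem_graph_iff x (A x)).1 (A.mem_graph x)

theorem isFormalAdjoint : A.IsFormalAdjoint A := by
  intro x y
  obtain ⟨g, hgx, hLg⟩ := h.exists_preimage x
  obtain ⟨f, hfy, hLf⟩ := h.exists_preimage y
  rw [← hgx, ← hfy, ← h.isSelfAdjoint_outer.isSymmetric.apply_clm, ← hLg,
    h.isSelfAdjoint_outer.isSymmetric.apply_clm, ← hLf, h.isSelfAdjoint_inner.isSymmetric.apply_clm]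

theorem ofReal_re_inner (x : A.domain) {g : E} (hg : S g = x) :
    (((inner ℂ g (L g)).re : ℝ) : ℂ) = inner ℂ (x : E) (A x) := by
  obtain ⟨f, hf, hLf⟩ := h.exists_preimage x
  obtain rfl : f = g := h.injective_outer (hf.trans hg.symm)
  rw [← hf, h.isSelfAdjoint_outer.isSymmetric.apply_clm, ← hLf]
  refine Complex.conj_eq_iff_re.1 ?_
  rw [inner_conj_symm, h.isSelfAdjoint_inner.isSymmetric.apply_clm]

theorem exists_apply_add_smul_eq {lam : ℝ} {M : E ≃L[ℂ] E}
    (hM : ∀ g, M g = L g + (lam : ℂ) • S (S g)) (η : E) :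
    ∃ x : A.domain, (x : E) = S (M.symm (S η)) ∧ A x + (lam : ℂ) • (x : E) = η := by
  set g := M.symm (S η)
  have hgraph : (S g, η - (lam : ℂ) • S g) ∈ A.graph := by
    refine (h.mem_graph_iff _ _).2 ⟨g, rfl, ?_⟩
    have hMg : M g = S η := M.apply_symm_apply _
    rw [map_sub, map_smul, ← hMg, hM, add_sub_cancel_right]
  obtain ⟨x, hx, hAx⟩ := (LinearPMap.mem_graph_iff _).1 hgraph
  exact ⟨x, hx, by rw [hAx, hx, sub_add_cancel]⟩

theorem exists_seq_tendsto {lam : ℝ} {M : E ≃L[ℂ] E}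
    (hM : ∀ g, M g = L g + (lam : ℂ) • S (S g)) (f : E) :
    ∃ g : ℕ → E, (∀ j, S (g j) ∈ A.domain) ∧ Tendsto g atTop (𝓝 f) := by
  have hdense : DenseRange fun η => M.symm (S η) :=
    M.symm.surjective.denseRange.comp
      (denseRange_of_isSelfAdjoint h.isSelfAdjoint_outer h.injective_outer) M.symm.continuous
  obtain ⟨g, hg, hlim⟩ := mem_closure_iff_seq_limit.1 (hdense f)
  refine ⟨g, fun j => ?_, hlim⟩
  obtain ⟨η, hη⟩ := hg j
  obtain ⟨x, hx, -⟩ := h.exists_apply_add_smul_eq hM η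
  rw [← hη, ← hx]
  exact x.2

theorem isFormOf {lam c : ℝ} (hc : 0 < c)
    (hcoer : ∀ g, c * ‖g‖ ^ 2 ≤ (inner ℂ g (L g)).re + lam * ‖S g‖ ^ 2)
    {D : Submodule ℂ E} (hD : ∀ Ψ, Ψ ∈ D ↔ ∃ g, S g = Ψ) {q : D → ℝ}
    (hq : ∀ (Ψ : D) (g : E), S g = Ψ → q Ψ = (inner ℂ g (L g)).re) :
    IsFormOf D q A := by
  obtain ⟨M, hM⟩ := exists_continuousLinearEquiv_of_coercive h.isSelfAdjoint_outer hc hcoer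
  have solve := h.exists_apply_add_smul_eq hM
  choose R hR using fun Ψ : D => (hD Ψ).1 Ψ.2
  have hqR : ∀ Ψ, q Ψ = (inner ℂ (R Ψ) (L (R Ψ))).re := fun Ψ => hq Ψ _ (hR Ψ)
  have hR_sub : ∀ Ψ Φ, R (Ψ - Φ) = R Ψ - R Φ := fun Ψ Φ =>
    h.injective_outer (by rw [map_sub, hR, hR, hR]; rfl)
  have domain_le : A.domain ≤ D := fun x hx => by
    obtain ⟨g, hg, -⟩ := h.exists_preimage ⟨x, hx⟩
    exact (hD x).2 ⟨g, hg⟩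
  refine ⟨isSelfAdjoint_of_surjective_add_smul h.isFormalAdjoint fun η =>
    (solve η).imp fun _ => And.right, ⟨-lam, fun Ψ => ?_⟩, domain_le, fun Ψ => ?_,
    fun u Ψ hu hqu => ?_, fun Ψ => ?_⟩
  · have hle : 0 ≤ (inner ℂ (R Ψ) (L (R Ψ))).re + lam * ‖(Ψ : E)‖ ^ 2 := by
      rw [← hR Ψ]
      exact le_trans (by positivity) (hcoer (R Ψ))
    rw [hqR]
    change -lam * ‖(Ψ : E)‖ ^ 2 ≤ _
    linarith
  · rw [hqR, h.ofReal_re_inner Ψ (hR _)]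
  · simp only [hqR, hR_sub] at hqu ⊢
    obtain ⟨f, hf⟩ := exists_tendsto_of_coercive hc hcoer
      (g := fun j => R (u j)) (by simpa only [hR] using hu) hqu
    have hSf : S f = Ψ := tendsto_nhds_unique ((S.continuous.tendsto f).comp hf)
      (hu.congr fun j => (hR (u j)).symm)
    have hΨ : Ψ ∈ D := (hD Ψ).2 ⟨f, hSf⟩
    obtain rfl : R ⟨Ψ, hΨ⟩ = f := h.injective_outer ((hR _).trans hSf.symm)
    exact ⟨hΨ, tendsto_re_inner_sub L hf⟩
  · obtain ⟨g, hmem, hlim⟩ := h.exists_seq_tendsto hM (R Ψ)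
    have hRg : ∀ j, R ⟨S (g j), domain_le (hmem j)⟩ = g j := fun j => h.injective_outer (hR _)
    refine ⟨fun j => ⟨S (g j), domain_le (hmem j)⟩, hmem, ?_, ?_⟩
    · rw [← hR Ψ]
      exact (S.continuous.tendsto _).comp hlim
    · simpa only [hqR, hR_sub, hRg] using tendsto_re_inner_sub L hlim

end IsInverseSandwich

end SelfAdjoint

/-! ### Regularized annihilation operators -/

section RegularizedAnnihilation

variable {E : Type*} [NormedAddCommGroup E] [InnerProductSpace ℂ E] [CompleteSpace E]

/-- The bounded products through which an annihilation operator `a` enters `K(P) + T(P)`: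
`S = H₀^{-1/2}`, `G = H₀^{-1/2} a H₀^{-1/2}`, `F = a H₀⁻¹`, `V = a H₀⁻¹ a H₀^{-1/2}` and
`W = a H₀⁻¹ a* H₀^{-1/2}`. As `a` and `a*` need not be operators on `E`, only the relations between
these products are recorded. -/
structure RegularizedAnnihilation (S G F V W : E →L[ℂ] E) : Prop where
  isSelfAdjoint : IsSelfAdjoint S
  injective : Function.Injective S
  outer_comp_F : S ∘L F = G ∘L S
  outer_comp_V : S ∘L V = G ∘L G
  outer_comp_W : S ∘L W = G ∘L G.adjoint

/-- `1 + β H₀^{-1/2} (a + a*) H₀^{-1/2}`, where `G = H₀^{-1/2} a H₀^{-1/2}`. -/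
def sandwiched (G : E →L[ℂ] E) (β : ℝ) : E →L[ℂ] E :=
  ContinuousLinearMap.id ℂ E + (β : ℂ) • (G + G.adjoint)

theorem sandwiched_apply (G : E →L[ℂ] E) (β : ℝ) (g : E) :
    sandwiched G β g = g + (β : ℂ) • (G g + G.adjoint g) := rfl

theorem isSelfAdjoint_sandwiched (G : E →L[ℂ] E) (β : ℝ) : IsSelfAdjoint (sandwiched G β) := by
  have hsum : IsSelfAdjoint (G + G.adjoint) := IsSelfAdjoint.add_star_self G
  exact (IsSelfAdjoint.one (E →L[ℂ] E)).add (IsSelfAdjoint.smul (Complex.conj_ofReal β) hsum)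

theorem re_inner_sandwiched (G : E →L[ℂ] E) (β : ℝ) (g : E) :
    (inner ℂ g (sandwiched G β g)).re = ‖g‖ ^ 2 + 2 * β * (inner ℂ g (G g)).re := by
  have hconj : (inner ℂ g (G.adjoint g)).re = (inner ℂ g (G g)).re := by
    rw [ContinuousLinearMap.adjoint_inner_right, ← inner_conj_symm, Complex.conj_re]
  have hself : (inner ℂ g g).re = ‖g‖ ^ 2 := inner_self_eq_norm_sq (𝕜 := ℂ) g
  rw [sandwiched_apply, inner_add_right, inner_smul_right, inner_add_right, Complex.add_re,
    Complex.re_ofReal_mul, Complex.add_re, hself, hconj]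
  ring

namespace RegularizedAnnihilation

variable {S G F V W : E →L[ℂ] E} (h : RegularizedAnnihilation S G F V W)
include h

theorem outer_F_apply (x : E) : S (F x) = G (S x) :=
  DFunLike.congr_fun h.outer_comp_F x

theorem outer_V_apply (x : E) : S (V x) = G (G x) :=
  DFunLike.congr_fun h.outer_comp_V x

theorem outer_W_apply (x : E) : S (W x) = G (G.adjoint x) :=
  DFunLike.congr_fun h.outer_comp_W x

theorem V_outer_apply (x : E) : V (S x) = F (F x) :=
  h.injective (by rw [h.outer_V_apply, h.outer_F_apply, h.outer_F_apply])

theorem F_adjoint_outer_apply (x : E) : F.adjoint (S x) = S (G.adjoint x) := by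
  have := DFunLike.congr_fun (congrArg ContinuousLinearMap.adjoint h.outer_comp_F) x
  simpa [ContinuousLinearMap.adjoint_comp, h.isSelfAdjoint.adjoint_eq] using this

theorem outer_V_adjoint_apply (x : E) : S (V.adjoint x) = F.adjoint (F.adjoint x) := by
  refine ext_inner_left ℂ fun y => ?_
  rw [← h.isSelfAdjoint.isSymmetric.apply_clm, ContinuousLinearMap.adjoint_inner_right,
    h.V_outer_apply, ContinuousLinearMap.adjoint_inner_right,
    ContinuousLinearMap.adjoint_inner_right]

theorem norm_adjoint_sq_le (g : E) : ‖G.adjoint g‖ ^ 2 ≤ ‖W‖ * ‖S g‖ * ‖g‖ := by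
  have hnorm : ((‖G.adjoint g‖ ^ 2 : ℝ) : ℂ) = inner ℂ (S g) (W g) := by
    rw [h.isSelfAdjoint.isSymmetric.apply_clm, h.outer_W_apply,
      ← ContinuousLinearMap.adjoint_inner_left, inner_self_eq_norm_sq_to_K]
    norm_cast
  calc ‖G.adjoint g‖ ^ 2 = ‖inner ℂ (S g) (W g)‖ := by
        rw [← hnorm, Complex.norm_real, Real.norm_of_nonneg (sq_nonneg _)]
    _ ≤ ‖S g‖ * ‖W g‖ := norm_inner_le_norm _ _
    _ ≤ ‖S g‖ * (‖W‖ * ‖g‖) := by gcongr; exact W.le_opNorm g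
    _ = ‖W‖ * ‖S g‖ * ‖g‖ := by ring

theorem coercive (β : ℝ) (g : E) :
    1 / 4 * ‖g‖ ^ 2 ≤ (inner ℂ g (sandwiched G β g)).re + 4 * β ^ 4 * ‖W‖ ^ 2 * ‖S g‖ ^ 2 := by
  have hinner : |(inner ℂ g (G g)).re| ≤ ‖G.adjoint g‖ * ‖g‖ := by
    rw [← ContinuousLinearMap.adjoint_inner_left]
    exact (Complex.abs_re_le_norm _).trans (norm_inner_le_norm _ _)
  have hβ : -(2 * (|β| * ‖G.adjoint g‖) * ‖g‖) ≤ 2 * β * (inner ℂ g (G g)).re := by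
    calc -(2 * (|β| * ‖G.adjoint g‖) * ‖g‖) = -(2 * |β| * (‖G.adjoint g‖ * ‖g‖)) := by ring
      _ ≤ -(2 * |β| * |(inner ℂ g (G g)).re|) := by gcongr
      _ = -|2 * β * (inner ℂ g (G g)).re| := by rw [abs_mul, abs_mul, abs_two]
      _ ≤ 2 * β * (inner ℂ g (G g)).re := neg_abs_le _
  have young₁ : 2 * (|β| * ‖G.adjoint g‖) * ‖g‖
      ≤ 2 * (β ^ 2 * ‖G.adjoint g‖ ^ 2) + 1 / 2 * ‖g‖ ^ 2 := by
    rw [← sq_abs β]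
    nlinarith [sq_nonneg (2 * (|β| * ‖G.adjoint g‖) - ‖g‖)]
  have young₂ : 2 * (β ^ 2 * (‖W‖ * ‖S g‖ * ‖g‖))
      ≤ 4 * β ^ 4 * ‖W‖ ^ 2 * ‖S g‖ ^ 2 + 1 / 4 * ‖g‖ ^ 2 := by
    nlinarith [sq_nonneg (2 * (β ^ 2 * (‖W‖ * ‖S g‖)) - 1 / 2 * ‖g‖)]
  have hadj := mul_le_mul_of_nonneg_left (h.norm_adjoint_sq_le g) (sq_nonneg β)
  rw [re_inner_sandwiched]
  linarith

/-- Iterating `Ψ = H₀⁻¹X - β H₀⁻¹a*Ψ` twice expresses `Ψ` through `S` applied to bounded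
expressions, so that `Ψ` lies in the form domain. -/
theorem exists_preimage_iff (β : ℝ) (Ψ X : E) :
    Ψ + (β : ℂ) • F.adjoint Ψ = S (S X) ↔
      ∃ g, S g = Ψ ∧ g + (β : ℂ) • G.adjoint g = S X := by
  have preimage : ∀ g, S g = Ψ →
      Ψ + (β : ℂ) • F.adjoint Ψ = S (g + (β : ℂ) • G.adjoint g) := by
    rintro g rfl
    rw [h.F_adjoint_outer_apply, map_add, map_smul]
  constructor
  · intro hΨ
    obtain ⟨g, hg⟩ : ∃ g, S g = Ψ := by
      refine ⟨S X - (β : ℂ) • (G.adjoint (S X) - (β : ℂ) • V.adjoint Ψ), ?_⟩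
      rw [map_sub, map_smul, map_sub, map_smul, h.outer_V_adjoint_apply,
        ← h.F_adjoint_outer_apply, ← hΨ, map_add, map_smul, add_sub_cancel_right,
        add_sub_cancel_right]
    exact ⟨g, hg, h.injective ((preimage g hg).symm.trans hΨ)⟩
  · rintro ⟨g, hg, hX⟩
    rw [preimage g hg, hX]

theorem sandwiched_eq_outer_iff (β : ℝ) (g η : E) :
    sandwiched G β g = S η ↔
      ∃ X, g + (β : ℂ) • G.adjoint g = S X ∧ η = X + (β : ℂ) • (F X - (β : ℂ) • W g) := by
  have outer_F : ∀ X, g + (β : ℂ) • G.adjoint g = S X →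
      S (F X - (β : ℂ) • W g) = G g := by
    intro X hX
    rw [map_sub, map_smul, h.outer_F_apply, h.outer_W_apply, ← hX, map_add, map_smul,
      add_sub_cancel_right]
  constructor
  · intro hη
    set Y := F η - (β : ℂ) • V g - (β : ℂ) • W g with hY
    have hSY : S Y = G g := by
      rw [hY, map_sub, map_sub, map_smul, map_smul, h.outer_F_apply, h.outer_V_apply,
        h.outer_W_apply, ← hη, sandwiched_apply, map_add, map_smul, map_add]
      module
    have hX : g + (β : ℂ) • G.adjoint g = S (η - (β : ℂ) • Y) := by
      rw [map_sub, map_smul, hSY, ← hη, sandwiched_apply]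
      module
    refine ⟨η - (β : ℂ) • Y, hX, ?_⟩
    rw [h.injective ((outer_F _ hX).trans hSY.symm), sub_add_cancel]
  · rintro ⟨X, hX, rfl⟩
    rw [map_add, map_smul, outer_F X hX, ← hX, sandwiched_apply]
    module

theorem isFormOf_sandwiched {β : ℝ} {A : E →ₗ.[ℂ] E}
    (hA : ∀ Ψ η, (Ψ, η) ∈ A.graph ↔ ∃ g, S g = Ψ ∧ sandwiched G β g = S η)
    {D : Submodule ℂ E} (hD : ∀ Ψ, Ψ ∈ D ↔ ∃ g, S g = Ψ) {q : D → ℝ}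
    (hq : ∀ (Ψ : D) (g : E), S g = Ψ → q Ψ = (inner ℂ g (sandwiched G β g)).re) :
    IsFormOf D q A :=
  IsInverseSandwich.isFormOf ⟨h.isSelfAdjoint, h.injective, isSelfAdjoint_sandwiched G β, hA⟩
    (by norm_num) (h.coercive β) hD hq

end RegularizedAnnihilation

end RegularizedAnnihilation

/-! ### Bounded operators on Hilbert sums -/

section HilbertSum

variable {𝕜 ι κ : Type*} [RCLike 𝕜] {h : κ → Type*} {h' : ι → Type*}
  [∀ k, NormedAddCommGroup (h k)] [∀ k, InnerProductSpace 𝕜 (h k)]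
  [∀ i, NormedAddCommGroup (h' i)] [∀ i, InnerProductSpace 𝕜 (h' i)]

theorem hasSum_norm_sq (g : lp h 2) : HasSum (fun k => ‖g k‖ ^ 2) (‖g‖ ^ 2) := by
  simpa using lp.hasSum_norm (p := 2) (by norm_num) g

theorem summable_norm_map_sq_and_tsum_le (τ : ι ↪ κ) {t : ∀ i, h (τ i) →L[𝕜] h' i} {C : ℝ}
    (ht : ∀ i, ‖t i‖ ≤ C) (g : lp h 2) :
    Summable (fun i => ‖t i (g (τ i))‖ ^ 2) ∧ ∑' i, ‖t i (g (τ i))‖ ^ 2 ≤ C ^ 2 * ‖g‖ ^ 2 := by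
  have hg := hasSum_norm_sq g
  have hsub : Summable fun i => ‖g (τ i)‖ ^ 2 := hg.summable.comp_injective τ.injective
  have hle : ∀ i, ‖t i (g (τ i))‖ ^ 2 ≤ C ^ 2 * ‖g (τ i)‖ ^ 2 := fun i => by
    rw [← mul_pow]
    exact pow_le_pow_left₀ (norm_nonneg _) ((t i).le_of_opNorm_le (ht i) _) 2
  have hsum : Summable fun i => ‖t i (g (τ i))‖ ^ 2 :=
    .of_nonneg_of_le (fun i => by positivity) hle (hsub.mul_left _)
  refine ⟨hsum, ?_⟩
  calc ∑' i, ‖t i (g (τ i))‖ ^ 2 ≤ ∑' i, C ^ 2 * ‖g (τ i)‖ ^ 2 :=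
        hsum.tsum_le_tsum hle (hsub.mul_left _)
    _ = C ^ 2 * ∑' i, ‖g (τ i)‖ ^ 2 := tsum_mul_left
    _ ≤ C ^ 2 * ∑' k, ‖g k‖ ^ 2 := by
        gcongr
        exact tsum_comp_le_tsum_of_inj hg.summable (fun k => by positivity) τ.injective
    _ = C ^ 2 * ‖g‖ ^ 2 := by rw [hg.tsum_eq]

theorem memℓp_map (τ : ι ↪ κ) {t : ∀ i, h (τ i) →L[𝕜] h' i} (ht : ∃ C, ∀ i, ‖t i‖ ≤ C)
    (g : lp h 2) : Memℓp (fun i => t i (g (τ i))) 2 := by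
  obtain ⟨C, hC⟩ := ht
  rw [memℓp_gen_iff (by norm_num)]
  simpa using (summable_norm_map_sq_and_tsum_le τ hC g).1

/-- The bounded operator `(gₖ)ₖ ↦ (tᵢ g_{τ i})ᵢ` between Hilbert sums: for `τ = id` it preserves the
number of particles, for `τ i = i + m` it removes `m` of them. -/
def hilbertSumMap (τ : ι ↪ κ) (t : ∀ i, h (τ i) →L[𝕜] h' i) (ht : ∃ C, ∀ i, ‖t i‖ ≤ C) :
    lp h 2 →L[𝕜] lp h' 2 :=
  LinearMap.mkContinuousOfExistsBound
    { toFun := fun g => ⟨fun i => t i (g (τ i)), memℓp_map τ ht g⟩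
      map_add' := fun f g => by ext i; exact map_add (t i) _ _
      map_smul' := fun c f => by ext i; exact map_smul (t i) _ _ } <| by
    obtain ⟨C, hC⟩ := ht
    refine ⟨|C|, fun g => abs_le_of_sq_le_sq' ?_ (by positivity) |>.2⟩
    rw [mul_pow, sq_abs, ← (hasSum_norm_sq _).tsum_eq]
    exact (summable_norm_map_sq_and_tsum_le τ hC g).2

variable {τ : ι ↪ κ} {t : ∀ i, h (τ i) →L[𝕜] h' i} (ht : ∃ C, ∀ i, ‖t i‖ ≤ C)

theorem hilbertSumMap_apply (g : lp h 2) (i : ι) : hilbertSumMap τ t ht g i = t i (g (τ i)) := rfl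

variable [∀ k, CompleteSpace (h k)] [∀ i, CompleteSpace (h' i)]

theorem adjoint_hilbertSumMap_apply (Ψ : lp h' 2) (i : ι) :
    (hilbertSumMap τ t ht).adjoint Ψ (τ i) = (t i).adjoint (Ψ i) := by
  classical
  refine ext_inner_left 𝕜 fun x => ?_
  rw [← lp.inner_single_left, ContinuousLinearMap.adjoint_inner_right, lp.inner_eq_tsum,
    tsum_eq_single i]
  · rw [hilbertSumMap_apply, lp.single_apply_self, ContinuousLinearMap.adjoint_inner_right]
  · intro j hj
    rw [hilbertSumMap_apply, lp.single_apply_ne _ _ _ (τ.injective.ne hj), map_zero,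
      inner_zero_left]

theorem adjoint_hilbertSumMap_apply_of_notMem_range (Ψ : lp h' 2) {k : κ} (hk : k ∉ Set.range τ) :
    (hilbertSumMap τ t ht).adjoint Ψ k = 0 := by
  classical
  refine ext_inner_left 𝕜 fun x => ?_
  have hsingle : ∀ i, hilbertSumMap τ t ht (lp.single 2 k x) i = 0 := fun i => by
    rw [hilbertSumMap_apply, lp.single_apply_ne _ _ _ fun hik => hk ⟨i, hik⟩, map_zero]
  rw [← lp.inner_single_left, ContinuousLinearMap.adjoint_inner_right, lp.inner_eq_tsum]
  simp only [hsingle, inner_zero_left, tsum_zero, inner_zero_right]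

end HilbertSum

/-! ### Weighted composition operators on `L²` -/

section WeightedComp

variable {X Y : Type*} [MeasurableSpace X] [MeasurableSpace Y] {μ : Measure X} {ν : Measure Y}

theorem eLpNorm_two_sq_eq_lintegral {E : Type*} [NormedAddCommGroup E] (μ : Measure X)
    (f : X → E) :
    eLpNorm f 2 μ ^ 2 = ∫⁻ x, ‖f x‖ₑ ^ 2 ∂μ := by
  have := eLpNorm_nnreal_pow_eq_lintegral (f := f) (μ := μ) (p := 2) two_ne_zero
  simpa only [NNReal.coe_ofNat, ENNReal.coe_ofNat, ENNReal.rpow_two] using this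

/-- The weight `w` and the map `φ` define a bounded operator `f ↦ w · (f ∘ φ)` from `L²(ν)` to
`L²(μ)`, of norm at most `√C`. -/
structure IsBoundedWeight (φ : X → Y) (w : X → ℝ) (C : ℝ) (μ : Measure X) (ν : Measure Y) :
    Prop where
  quasiMeasurePreserving : Measure.QuasiMeasurePreserving φ μ ν
  measurable : Measurable w
  lintegral_le : ∀ F : Y → ENNReal, Measurable F →
    ∫⁻ x, ENNReal.ofReal (w x ^ 2) * F (φ x) ∂μ ≤ ENNReal.ofReal C * ∫⁻ y, F y ∂ν

namespace IsBoundedWeight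

variable {φ : X → Y} {w : X → ℝ} {C : ℝ} (h : IsBoundedWeight φ w C μ ν)
include h

theorem eLpNorm_le (f : Lp ℂ 2 ν) :
    eLpNorm (fun x => (w x : ℂ) * f (φ x)) 2 μ ≤ ENNReal.ofReal √C * eLpNorm f 2 ν := by
  have hsq : ∀ x, ‖(w x : ℂ) * f (φ x)‖ₑ ^ 2 = ENNReal.ofReal (w x ^ 2) * ‖f (φ x)‖ₑ ^ 2 := by
    intro x
    rw [enorm_mul, mul_pow, ← sq_abs, ENNReal.ofReal_pow (abs_nonneg _), ← Real.norm_eq_abs,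
      ← Complex.norm_real, ofReal_norm]
  refine (ENNReal.pow_le_pow_left_iff two_ne_zero).1 ?_
  rw [mul_pow, eLpNorm_two_sq_eq_lintegral, eLpNorm_two_sq_eq_lintegral]
  simp only [hsq]
  refine (h.lintegral_le _ ((Lp.stronglyMeasurable f).measurable.enorm.pow_const 2)).trans ?_
  gcongr
  rcases le_total 0 C with hC | hC
  · rw [← ENNReal.ofReal_pow (Real.sqrt_nonneg C), Real.sq_sqrt hC]
  · simp [ENNReal.ofReal_of_nonpos hC]

theorem memLp (f : Lp ℂ 2 ν) : MemLp (fun x => (w x : ℂ) * f (φ x)) 2 μ := by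
  refine ⟨?_, (h.eLpNorm_le f).trans_lt
    (ENNReal.mul_lt_top ENNReal.ofReal_lt_top (Lp.eLpNorm_lt_top f))⟩
  have hφ := h.quasiMeasurePreserving.measurable
  exact ((Complex.measurable_ofReal.comp h.measurable).mul
    ((Lp.stronglyMeasurable f).measurable.comp hφ)).aestronglyMeasurable

/-- The weighted composition operator `f ↦ w · (f ∘ φ)`. -/
def weightedComp : Lp ℂ 2 ν →L[ℂ] Lp ℂ 2 μ :=
  LinearMap.mkContinuous
    { toFun := fun f => (h.memLp f).toLp
      map_add' := fun f g => by
        rw [← MemLp.toLp_add]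
        refine MemLp.toLp_congr _ _ ?_
        filter_upwards [h.quasiMeasurePreserving.ae (Lp.coeFn_add f g)] with x hx
        simp only [Pi.add_apply, hx, mul_add]
      map_smul' := fun c f => by
        rw [RingHom.id_apply, ← MemLp.toLp_const_smul]
        refine MemLp.toLp_congr _ _ ?_
        filter_upwards [h.quasiMeasurePreserving.ae (Lp.coeFn_smul c f)] with x hx
        simp only [Pi.smul_apply, hx, smul_eq_mul]
        ring } √C fun f => by
    rw [← ENNReal.ofReal_le_ofReal_iff (by positivity), ENNReal.ofReal_mul (by positivity),
      ofReal_norm, ofReal_norm, Lp.enorm_def, Lp.enorm_def]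
    exact (eLpNorm_congr_ae (h.memLp f).coeFn_toLp).trans_le (h.eLpNorm_le f)

theorem weightedComp_coe (f : Lp ℂ 2 ν) :
    h.weightedComp f =ᵐ[μ] fun x => (w x : ℂ) * f (φ x) := (h.memLp f).coeFn_toLp

theorem norm_weightedComp_le : ‖h.weightedComp‖ ≤ √C :=
  LinearMap.mkContinuous_norm_le _ (Real.sqrt_nonneg C) _

end IsBoundedWeight

end WeightedComp

/-! ### Multiplication operators on `L²` -/

section Multiplication

variable {X : Type*} [MeasurableSpace X] {μ : Measure X} {w : X → ℝ} {C : ℝ}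

theorem isBoundedWeight_id (hw : Measurable w) (hC : ∀ x, w x ^ 2 ≤ C) :
    IsBoundedWeight id w C μ μ where
  quasiMeasurePreserving := .id μ
  measurable := hw
  lintegral_le F hF := by
    rw [← lintegral_const_mul _ hF]
    refine lintegral_mono fun x => ?_
    dsimp only [id]
    gcongr
    exact hC x

namespace IsBoundedWeight

variable (h : IsBoundedWeight id w C μ μ)
include h

theorem isSelfAdjoint_weightedComp : IsSelfAdjoint h.weightedComp := by
  rw [ContinuousLinearMap.isSelfAdjoint_iff_isSymmetric]
  intro f g
  rw [L2.inner_def, L2.inner_def]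
  refine integral_congr_ae ?_
  filter_upwards [h.weightedComp_coe f, h.weightedComp_coe g] with x hf hg
  simp only [ContinuousLinearMap.coe_coe, hf, hg, RCLike.inner_apply, map_mul,
    Complex.conj_ofReal, id]
  ring

theorem injective_weightedComp (hw : ∀ x, w x ≠ 0) : Function.Injective h.weightedComp := by
  intro f g hfg
  refine Lp.ext ?_
  have hf := h.weightedComp_coe f
  rw [hfg] at hf
  filter_upwards [hf, h.weightedComp_coe g] with x hfx hgx
  exact mul_left_cancel₀ (Complex.ofReal_ne_zero.2 (hw x)) (hfx.symm.trans hgx)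

end IsBoundedWeight

end Multiplication

/-! ### The adjoint as a fibre integral -/

section FibreIntegral

namespace IsBoundedWeight

variable {X Y : Type*} [MeasurableSpace X] [MeasurableSpace Y] {μ : Measure X} {ν : Measure Y}
  {φ : X → Y} {w : X → ℝ} {C : ℝ} (h : IsBoundedWeight φ w C μ ν) {s : Set Y}
include h

theorem weightedComp_indicatorConstLp (hs : MeasurableSet s) (hνs : ν s ≠ ⊤) :
    h.weightedComp (indicatorConstLp 2 hs hνs 1)
      =ᵐ[μ] (φ ⁻¹' s).indicator fun x => (w x : ℂ) := by
  filter_upwards [h.weightedComp_coe (indicatorConstLp 2 hs hνs 1),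
    h.quasiMeasurePreserving.ae (indicatorConstLp_coeFn (hs := hs) (hμs := hνs) (c := (1 : ℂ)))]
    with x hx hind
  rw [hx, hind]
  by_cases hmem : φ x ∈ s <;> simp [Set.indicator, hmem]

theorem inner_weightedComp_indicatorConstLp_ae_eq (hs : MeasurableSet s) (hνs : ν s ≠ ⊤)
    (f : Lp ℂ 2 μ) :
    (fun x => inner ℂ (h.weightedComp (indicatorConstLp 2 hs hνs 1) x) (f x))
      =ᵐ[μ] (φ ⁻¹' s).indicator fun x => (w x : ℂ) * f x := by
  filter_upwards [h.weightedComp_indicatorConstLp hs hνs] with x hx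
  rw [hx]
  by_cases hmem : x ∈ φ ⁻¹' s <;> simp [hmem, mul_comm]

theorem integrableOn_mul_preimage (hs : MeasurableSet s) (hνs : ν s ≠ ⊤) (f : Lp ℂ 2 μ) :
    IntegrableOn (fun x => (w x : ℂ) * f x) (φ ⁻¹' s) μ := by
  rw [← integrable_indicator_iff (h.quasiMeasurePreserving.measurable hs)]
  exact (L2.integrable_inner _ f).congr (h.inner_weightedComp_indicatorConstLp_ae_eq hs hνs f)

theorem setIntegral_adjoint_weightedComp (hs : MeasurableSet s) (hνs : ν s ≠ ⊤) (f : Lp ℂ 2 μ) :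
    ∫ y in s, h.weightedComp.adjoint f y ∂ν = ∫ x in φ ⁻¹' s, (w x : ℂ) * f x ∂μ := by
  rw [← L2.inner_indicatorConstLp_one (𝕜 := ℂ) hs hνs, ContinuousLinearMap.adjoint_inner_right,
    L2.inner_def, integral_congr_ae (h.inner_weightedComp_indicatorConstLp_ae_eq hs hνs f),
    integral_indicator (h.quasiMeasurePreserving.measurable hs)]

end IsBoundedWeight

variable {X : Type*} [MeasureSpace X] [SigmaFinite (volume : Measure X)] {n : ℕ}

theorem measurePreserving_cons (n : ℕ) :
    MeasurePreserving (fun p : X × (Fin n → X) => (Fin.cons p.1 p.2 : Fin (n + 1) → X)) := by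
  have h := (volume_preserving_piFinSuccAbove (fun _ : Fin (n + 1) => X) 0).symm
  convert! h using 1
  funext p
  simp [MeasurableEquiv.piFinSuccAbove, Fin.insertNthEquiv]

theorem lintegral_cons {F : (Fin (n + 1) → X) → ENNReal} (hF : Measurable F) :
    ∫⁻ k, F k = ∫⁻ y : Fin n → X, ∫⁻ ξ : X, F (Fin.cons ξ y) := by
  have hcons := measurePreserving_cons (X := X) n
  rw [← hcons.lintegral_comp hF, Measure.volume_eq_prod]
  exact lintegral_prod_symm' _ (hF.comp hcons.measurable)

theorem quasiMeasurePreserving_tail :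
    Measure.QuasiMeasurePreserving (Fin.tail : (Fin (n + 1) → X) → Fin n → X) volume volume := by
  have h := volume_preserving_piFinSuccAbove (fun _ : Fin (n + 1) => X) 0
  exact Measure.quasiMeasurePreserving_snd.comp h.quasiMeasurePreserving

theorem measurePreserving_cons_restrict {s : Set (Fin n → X)} (hs : MeasurableSet s) :
    MeasurePreserving (fun p : X × (Fin n → X) => (Fin.cons p.1 p.2 : Fin (n + 1) → X))
      ((volume : Measure X).prod (volume.restrict s)) (volume.restrict (Fin.tail ⁻¹' s)) := by
  have h := (measurePreserving_cons (X := X) n).restrict_preimage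
    (quasiMeasurePreserving_tail.measurable hs)
  have hpre : (fun p : X × (Fin n → X) => (Fin.cons p.1 p.2 : Fin (n + 1) → X)) ⁻¹'
      (Fin.tail ⁻¹' s) = Set.univ ×ˢ s := by
    ext p
    simp only [Set.mem_preimage, Fin.tail_cons, Set.mem_prod, Set.mem_univ, true_and]
  rwa [hpre, Measure.volume_eq_prod, ← Measure.prod_restrict, Measure.restrict_univ] at h

theorem isBoundedWeight_tail {w : (Fin (n + 1) → X) → ℝ} {C : ℝ} (hw : Measurable w)
    (hC : ∀ y : Fin n → X, ∫⁻ ξ, ENNReal.ofReal (w (Fin.cons ξ y) ^ 2) ≤ ENNReal.ofReal C) :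
    IsBoundedWeight Fin.tail w C volume volume where
  quasiMeasurePreserving := quasiMeasurePreserving_tail
  measurable := hw
  lintegral_le F hF := by
    have hmeas : Measurable fun k => ENNReal.ofReal (w k ^ 2) * F (Fin.tail k) :=
      (hw.pow_const 2).ennreal_ofReal.mul (hF.comp quasiMeasurePreserving_tail.measurable)
    rw [lintegral_cons hmeas, ← lintegral_const_mul _ hF]
    refine lintegral_mono fun y => ?_
    have hcons : Measurable fun ξ : X => ENNReal.ofReal (w (Fin.cons ξ y) ^ 2) :=
      ((hw.comp ((measurePreserving_cons n).measurable.comp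
        measurable_prodMk_right)).pow_const 2).ennreal_ofReal
    simp only [Fin.tail_cons]
    rw [lintegral_mul_const _ hcons]
    gcongr
    exact hC y

namespace IsBoundedWeight

variable {w : (Fin (n + 1) → X) → ℝ} {C : ℝ} (h : IsBoundedWeight Fin.tail w C volume volume)
include h

theorem integrable_cons_restrict {s : Set (Fin n → X)} (hs : MeasurableSet s)
    (hs' : volume s ≠ ⊤) (f : Lp ℂ 2 (volume : Measure (Fin (n + 1) → X))) :
    Integrable (fun p : X × (Fin n → X) =>
        (w (Fin.cons p.1 p.2) : ℂ) * f (Fin.cons p.1 p.2))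
      ((volume : Measure X).prod (volume.restrict s)) :=
  (measurePreserving_cons_restrict hs).integrable_comp_of_integrable
    (h.integrableOn_mul_preimage hs hs' f)

theorem ae_integrable_cons (f : Lp ℂ 2 (volume : Measure (Fin (n + 1) → X))) :
    ∀ᵐ y : Fin n → X, Integrable fun ξ : X => (w (Fin.cons ξ y) : ℂ) * f (Fin.cons ξ y) :=
  ae_of_forall_measure_lt_top_ae_restrict _ fun _ hs hs' =>
    (h.integrable_cons_restrict hs hs'.ne f).prod_left_ae

theorem adjoint_weightedComp_ae_eq (f : Lp ℂ 2 (volume : Measure (Fin (n + 1) → X))) :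
    h.weightedComp.adjoint f
      =ᵐ[volume] fun y => ∫ ξ : X, (w (Fin.cons ξ y) : ℂ) * f (Fin.cons ξ y) := by
  refine ae_eq_of_forall_setIntegral_eq_of_sigmaFinite (fun s _ hs' => ?_)
    (fun s hs hs' => (h.integrable_cons_restrict hs hs'.ne f).integral_prod_right)
    fun s hs hs' => ?_
  · exact integrableOn_Lp_of_measure_ne_top _ fact_one_le_two_ennreal.elim hs'.ne
  · have hcons := measurePreserving_cons_restrict (X := X) hs
    have hf : AEStronglyMeasurable (fun k => (w k : ℂ) * f k)
        (volume.restrict (Fin.tail ⁻¹' s)) := (h.integrableOn_mul_preimage hs hs'.ne f).1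
    rw [h.setIntegral_adjoint_weightedComp hs hs'.ne, ← hcons.map_eq,
      integral_map hcons.aemeasurable (hcons.map_eq ▸ hf),
      integral_prod_symm _ (h.integrable_cons_restrict hs hs'.ne f)]

end IsBoundedWeight

end FibreIntegral

/-! ### The form factor -/

section FormFactor

theorem integrableOn_inv_add_sq_Ioi {m : ℝ} (hm : 0 < m) :
    IntegrableOn (fun y : ℝ => (y ^ 2 + m)⁻¹) (Set.Ioi 0) ∧
      ∫ y in Set.Ioi (0 : ℝ), (y ^ 2 + m)⁻¹ = Real.pi / (2 * √m) := by
  have hs : 0 < √m := Real.sqrt_pos.2 hm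
  have hscale : ∀ y : ℝ, (y ^ 2 + m)⁻¹ = m⁻¹ * (1 + ((√m)⁻¹ * y) ^ 2)⁻¹ := fun y => by
    rw [← mul_inv, mul_add, mul_pow, inv_pow, Real.sq_sqrt hm.le, mul_one, ← mul_assoc,
      mul_inv_cancel₀ hm.ne', one_mul, add_comm]
  simp_rw [hscale]
  refine ⟨((integrable_inv_one_add_sq.comp_mul_left' (inv_ne_zero hs.ne')).const_mul
    _).integrableOn, ?_⟩
  rw [integral_const_mul, integral_comp_mul_left_Ioi (fun y => (1 + y ^ 2)⁻¹) 0 (inv_pos.2 hs),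
    mul_zero, integral_Ioi_inv_one_add_sq, Real.arctan_zero, sub_zero, inv_inv, smul_eq_mul]
  nth_rewrite 1 [← Real.sq_sqrt hm.le]
  field_simp

theorem lintegral_inv_sq_mul_inv_sq_add {m : ℝ} (hm : 0 < m) :
    ∫⁻ ξ : R3, ENNReal.ofReal ((‖ξ‖ ^ 2)⁻¹ * (‖ξ‖ ^ 2 + m)⁻¹)
      = ENNReal.ofReal (2 * Real.pi ^ 2 / √m) := by
  obtain ⟨hint, hval⟩ := integrableOn_inv_add_sq_Ioi hm
  have hdim : Module.finrank ℝ R3 = 3 := finrank_euclideanSpace_fin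
  have hball : volume.real (Metric.ball (0 : R3) 1) = Real.pi * 4 / 3 := by
    rw [measureReal_def, EuclideanSpace.volume_ball_fin_three, ENNReal.ofReal_one, one_pow,
      one_mul, ENNReal.toReal_ofReal (by positivity)]
  have hjac : ∀ y ∈ Set.Ioi (0 : ℝ), (y ^ 2 + m)⁻¹
      = y ^ (Module.finrank ℝ R3 - 1) • ((y ^ 2)⁻¹ * (y ^ 2 + m)⁻¹) := fun y hy => by
    rw [hdim, smul_eq_mul, ← mul_assoc, mul_inv_cancel₀ (pow_ne_zero _ (ne_of_gt hy)), one_mul]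
  have hint₃ : Integrable fun ξ : R3 => (‖ξ‖ ^ 2)⁻¹ * (‖ξ‖ ^ 2 + m)⁻¹ := by
    rw [integrable_fun_norm_addHaar volume (f := fun y : ℝ => (y ^ 2)⁻¹ * (y ^ 2 + m)⁻¹)]
    exact hint.congr_fun hjac measurableSet_Ioi
  rw [← ofReal_integral_eq_lintegral_ofReal hint₃ (Eventually.of_forall fun ξ => by positivity),
    integral_fun_norm_addHaar volume (fun y : ℝ => (y ^ 2)⁻¹ * (y ^ 2 + m)⁻¹),
    ← setIntegral_congr_fun measurableSet_Ioi hjac, hval, hdim, hball, nsmul_eq_mul, smul_eq_mul]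
  congr 1
  push_cast
  ring

theorem inv_mul_inv_add_le_add {x y m : ℝ} (hx : 0 < x) (hy : 0 < y) (hm : 0 < m) :
    x⁻¹ * (y + m)⁻¹ ≤ x⁻¹ * (x + m)⁻¹ + y⁻¹ * (y + m)⁻¹ := by
  rcases le_total x y with hxy | hyx
  · exact le_add_of_le_of_nonneg (by gcongr) (by positivity)
  · exact le_add_of_nonneg_of_le (by positivity) (by gcongr)

theorem vhat_sq (ξ : R3) : vhat ξ ^ 2 = (16 * Real.pi ^ 2)⁻¹ * (‖ξ‖ ^ 2)⁻¹ := by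
  rw [vhat, ← mul_inv]
  ring

theorem measurable_vhat : Measurable vhat := by
  unfold vhat
  fun_prop

/-- Comparing `‖p - ξ‖` with `‖ξ‖` bounds the integral, uniformly in `p`, by twice its value at
`p = 0`. -/
theorem lintegral_vhat_sq_mul_inv_le (p : R3) {m : ℝ} (hm : 0 < m) :
    ∫⁻ ξ : R3, ENNReal.ofReal (vhat ξ ^ 2 * (‖p - ξ‖ ^ 2 + m)⁻¹)
      ≤ ENNReal.ofReal (1 / (4 * √m)) := by
  let F : R3 → ENNReal := fun ξ => ENNReal.ofReal ((‖ξ‖ ^ 2)⁻¹ * (‖ξ‖ ^ 2 + m)⁻¹)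
  have hF : Measurable F := by fun_prop
  have hne : ∀ q : R3, ∀ᵐ ξ : R3, ξ ≠ q := fun q => by simp [ae_iff]
  calc ∫⁻ ξ : R3, ENNReal.ofReal (vhat ξ ^ 2 * (‖p - ξ‖ ^ 2 + m)⁻¹)
      ≤ ∫⁻ ξ : R3, ENNReal.ofReal (16 * Real.pi ^ 2)⁻¹ * (F ξ + F (ξ - p)) := by
        refine lintegral_mono_ae ?_
        filter_upwards [hne 0, hne p] with ξ h0 hp
        have hξ : 0 < ‖ξ‖ := norm_pos_iff.2 h0
        have hξp : 0 < ‖ξ - p‖ := norm_pos_iff.2 (sub_ne_zero.2 hp)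
        rw [← ENNReal.ofReal_add (by positivity) (by positivity),
          ← ENNReal.ofReal_mul (by positivity), vhat_sq, mul_assoc, norm_sub_rev p ξ]
        gcongr
        exact inv_mul_inv_add_le_add (pow_pos hξ 2) (pow_pos hξp 2) hm
    _ = ENNReal.ofReal (1 / (4 * √m)) := by
        rw [lintegral_const_mul _ (by fun_prop), lintegral_add_left hF,
          lintegral_sub_right_eq_self F p, lintegral_inv_sq_mul_inv_sq_add hm,
          ← ENNReal.ofReal_add (by positivity) (by positivity),
          ← ENNReal.ofReal_mul (by positivity)]
        congr 1
        field_simp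
        norm_num

end FormFactor

/-! ### Permutations -/

section Permutations

variable {n : ℕ}

theorem permAct_coe (σ : Equiv.Perm (Fin n)) (f : L2n n) :
    permAct σ f =ᵐ[volume] fun k => f (k ∘ σ) :=
  Lp.coeFn_compMeasurePreserving f (measurePreserving_perm σ)

theorem ae_comp_perm (σ : Equiv.Perm (Fin n)) {p : (Fin n → R3) → Prop} (h : ∀ᵐ k, p k) :
    ∀ᵐ k : Fin n → R3, p (k ∘ σ) :=
  (measurePreserving_perm σ).quasiMeasurePreserving.ae h

theorem permAct_one (f : L2n n) : permAct 1 f = f :=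
  Lp.ext (permAct_coe 1 f)

theorem permAct_mul (σ τ : Equiv.Perm (Fin n)) (f : L2n n) :
    permAct (σ * τ) f = permAct σ (permAct τ f) := by
  refine Lp.ext ?_
  filter_upwards [permAct_coe (σ * τ) f, permAct_coe σ (permAct τ f),
    ae_comp_perm σ (permAct_coe τ f)] with k hστ hσ hτ
  rw [hστ, hσ, hτ, Equiv.Perm.coe_mul, Function.comp_assoc]

theorem inner_permAct_right (σ : Equiv.Perm (Fin n)) (f g : L2n n) :
    inner ℂ f (permAct σ g) = inner ℂ (permAct σ⁻¹ f) g := by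
  rw [← (permAct σ).inner_map_map (permAct σ⁻¹ f), ← permAct_mul, mul_inv_cancel, permAct_one]

theorem inner_permAct_bosons (σ : Equiv.Perm (Fin n)) (g : bosons n) (f : L2n n) :
    inner ℂ (g : L2n n) (permAct σ f) = inner ℂ (g : L2n n) f := by
  rw [inner_permAct_right, g.2 σ⁻¹]

theorem bosons_ext {f g : bosons n} (h : (f : L2n n) =ᵐ[volume] (g : L2n n)) : f = g :=
  Subtype.ext (Lp.ext h)

end Permutations

/-! ### The operators on `n`-particle components -/

section Levels

variable (P : R3) (n : ℕ)

theorem energy_pos (k : Fin n → R3) : 0 < energy P n k := by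
  unfold energy
  positivity

theorem le_energy (k : Fin n → R3) : (n : ℝ) + 1 ≤ energy P n k := by
  rw [energy, add_assoc]
  exact le_add_of_nonneg_left (by positivity)

theorem measurable_energy : Measurable (energy P n) := by
  unfold energy
  fun_prop

theorem energy_comp_perm (σ : Equiv.Perm (Fin n)) (k : Fin n → R3) :
    energy P n (k ∘ σ) = energy P n k := by
  simp only [energy, Function.comp_apply, Equiv.sum_comp σ k]

theorem energy_cons (ξ : R3) (k : Fin n → R3) :
    energy P (n + 1) (Fin.cons ξ k) = ‖(P - ∑ j, k j) - ξ‖ ^ 2 + ((n : ℝ) + 2) := by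
  simp only [energy, Fin.sum_univ_succ, Fin.cons_zero, Fin.cons_succ]
  rw [add_comm ξ, sub_add_eq_sub_sub]
  push_cast
  ring

/-- The weight `((P - ∑ⱼ kⱼ)² + n + 1)^{-1/2}` of the operator `H₀^{-1/2}`. -/
def invSqrtEnergy (k : Fin n → R3) : ℝ := (√(energy P n k))⁻¹

theorem invSqrtEnergy_pos (k : Fin n → R3) : 0 < invSqrtEnergy P n k :=
  inv_pos.2 (Real.sqrt_pos.2 (energy_pos P n k))

theorem invSqrtEnergy_sq (k : Fin n → R3) : invSqrtEnergy P n k ^ 2 = (energy P n k)⁻¹ := by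
  rw [invSqrtEnergy, inv_pow, Real.sq_sqrt (energy_pos P n k).le]

theorem measurable_invSqrtEnergy : Measurable (invSqrtEnergy P n) :=
  (measurable_energy P n).sqrt.inv

theorem invSqrtEnergy_comp_perm (σ : Equiv.Perm (Fin n)) (k : Fin n → R3) :
    invSqrtEnergy P n (k ∘ σ) = invSqrtEnergy P n k := by
  rw [invSqrtEnergy, invSqrtEnergy, energy_comp_perm]

theorem isBoundedWeight_invSqrtEnergy :
    IsBoundedWeight id (invSqrtEnergy P n) ((n : ℝ) + 1)⁻¹ volume volume :=
  isBoundedWeight_id (measurable_invSqrtEnergy P n) fun k => by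
    rw [invSqrtEnergy_sq]
    exact inv_anti₀ (by positivity) (le_energy P n k)

theorem weightedComp_invSqrtEnergy_mem_bosons (f : bosons n) :
    (isBoundedWeight_invSqrtEnergy P n).weightedComp f ∈ bosons n := fun σ => by
  have hcoe := (isBoundedWeight_invSqrtEnergy P n).weightedComp_coe (f : L2n n)
  refine Lp.ext ?_
  filter_upwards [permAct_coe σ ((isBoundedWeight_invSqrtEnergy P n).weightedComp f), hcoe,
    ae_comp_perm σ hcoe, permAct_coe σ (f : L2n n)] with k hσ hk hkσ hf
  rw [hσ, hkσ, hk, invSqrtEnergy_comp_perm, id, id, ← hf, f.2 σ]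

/-- `H₀^{-1/2}` on the `n`-particle component. -/
def invSqrtLevel : bosons n →L[ℂ] bosons n :=
  ((isBoundedWeight_invSqrtEnergy P n).weightedComp ∘L (bosons n).subtypeL).codRestrict (bosons n)
    (weightedComp_invSqrtEnergy_mem_bosons P n)

theorem invSqrtLevel_coe (f : bosons n) :
    (invSqrtLevel P n f : L2n n) =ᵐ[volume] fun k => (invSqrtEnergy P n k : ℂ) * (f : L2n n) k :=
  (isBoundedWeight_invSqrtEnergy P n).weightedComp_coe (f : L2n n)

theorem isSelfAdjoint_invSqrtLevel : IsSelfAdjoint (invSqrtLevel P n) := by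
  rw [ContinuousLinearMap.isSelfAdjoint_iff_isSymmetric]
  intro f g
  exact (isBoundedWeight_invSqrtEnergy P n).isSelfAdjoint_weightedComp.isSymmetric _ _

theorem injective_invSqrtLevel : Function.Injective (invSqrtLevel P n) := fun _ _ hfg =>
  Subtype.ext <| (isBoundedWeight_invSqrtEnergy P n).injective_weightedComp
    (fun k => (invSqrtEnergy_pos P n k).ne') (congrArg Subtype.val hfg)

theorem norm_invSqrtLevel_le : ‖invSqrtLevel P n‖ ≤ (√((n : ℝ) + 1))⁻¹ := by
  refine ContinuousLinearMap.opNorm_le_bound _ (by positivity) fun f => ?_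
  rw [← Real.sqrt_inv]
  exact ContinuousLinearMap.le_of_opNorm_le _
    (isBoundedWeight_invSqrtEnergy P n).norm_weightedComp_le (f : L2n n)

/-- The weight of the operator `f ↦ H₀^{-1/2} (v̂(k₁) f(k₂, …, kₙ₊₁))`. -/
def creatWeight (k : Fin (n + 1) → R3) : ℝ := invSqrtEnergy P (n + 1) k * vhat (k 0)

theorem isBoundedWeight_creatWeight :
    IsBoundedWeight Fin.tail (creatWeight P n) (1 / (4 * √((n : ℝ) + 2))) volume volume := by
  refine isBoundedWeight_tail ((measurable_invSqrtEnergy P (n + 1)).mul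
    (measurable_vhat.comp (measurable_pi_apply 0))) fun y => ?_
  simp only [creatWeight, mul_pow, invSqrtEnergy_sq, energy_cons, Fin.cons_zero]
  simp only [mul_comm _ (vhat _ ^ 2)]
  exact lintegral_vhat_sq_mul_inv_le _ (by positivity)

/-- The operator `f ↦ H₀^{-1/2} (v̂(k₁) f(k₂, …, kₙ₊₁))`, which is `H₀^{-1/2}a*(v)` up to
symmetrization. -/
def creatFirst : L2n n →L[ℂ] L2n (n + 1) := (isBoundedWeight_creatWeight P n).weightedComp

theorem creatFirst_coe (f : L2n n) :
    creatFirst P n f =ᵐ[volume] fun k => (creatWeight P n k : ℂ) * f (Fin.tail k) :=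
  (isBoundedWeight_creatWeight P n).weightedComp_coe f

variable {n}

theorem permAct_creatFirst (τ : Equiv.Perm (Fin n)) (f : L2n n) :
    permAct (Equiv.Perm.decomposeFin.symm (0, τ)) (creatFirst P n f)
      = creatFirst P n (permAct τ f) := by
  refine Lp.ext ?_
  filter_upwards [permAct_coe (Equiv.Perm.decomposeFin.symm (0, τ)) (creatFirst P n f),
    ae_comp_perm (Equiv.Perm.decomposeFin.symm (0, τ)) (creatFirst_coe P n f),
    creatFirst_coe P n (permAct τ f), quasiMeasurePreserving_tail.ae (permAct_coe τ f)]
    with k hperm hcreat hcreatτ hτ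
  have htail : Fin.tail (k ∘ Equiv.Perm.decomposeFin.symm (0, τ)) = Fin.tail k ∘ τ := by
    funext i
    simp [Fin.tail]
  rw [hperm, hcreat, hcreatτ, hτ, htail, creatWeight, creatWeight, invSqrtEnergy_comp_perm,
    Function.comp_apply, Equiv.Perm.decomposeFin_symm_apply_zero]

theorem permAct_creatFirst_congr (f : bosons n) {π π' : Equiv.Perm (Fin (n + 1))}
    (h : π 0 = π' 0) : permAct π (creatFirst P n f) = permAct π' (creatFirst P n f) := by
  obtain ⟨⟨p, τ⟩, hτ⟩ := Equiv.Perm.decomposeFin.symm.surjective (π'⁻¹ * π)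
  obtain rfl : p = 0 := by
    rw [← Equiv.Perm.decomposeFin_symm_apply_zero p τ, hτ, Equiv.Perm.mul_apply, h,
      ← Equiv.Perm.mul_apply, inv_mul_cancel, Equiv.Perm.one_apply]
  rw [← mul_inv_cancel_left π' π, ← hτ, permAct_mul, permAct_creatFirst, f.2 τ]

theorem adjoint_creatFirst_mem_bosons (g : bosons (n + 1)) :
    (creatFirst P n).adjoint g ∈ bosons n := fun τ => ext_inner_left ℂ fun f => by
  rw [inner_permAct_right, ContinuousLinearMap.adjoint_inner_right,
    ContinuousLinearMap.adjoint_inner_right, ← permAct_creatFirst, ← inner_conj_symm,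
    inner_permAct_bosons, inner_conj_symm]

variable (n)

/-- `a(v)H₀^{-1/2}` from the `(n + 1)`-particle to the `n`-particle component. -/
def annihLevel : bosons (n + 1) →L[ℂ] bosons n :=
  ((√((n : ℝ) + 1) : ℝ) : ℂ) •
    ((creatFirst P n).adjoint ∘L (bosons (n + 1)).subtypeL).codRestrict (bosons n)
      (adjoint_creatFirst_mem_bosons P)

theorem annihLevel_coe (g : bosons (n + 1)) :
    (annihLevel P n g : L2n n) =ᵐ[volume] fun k => ((√((n : ℝ) + 1) : ℝ) : ℂ) *
      ∫ ξ : R3, (creatWeight P n (Fin.cons ξ k) : ℂ) * (g : L2n (n + 1)) (Fin.cons ξ k) := by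
  filter_upwards [Lp.coeFn_smul ((√((n : ℝ) + 1) : ℝ) : ℂ) ((creatFirst P n).adjoint g),
    (isBoundedWeight_creatWeight P n).adjoint_weightedComp_ae_eq (g : L2n (n + 1))]
    with k hsmul hadj
  refine hsmul.trans ?_
  rw [Pi.smul_apply, smul_eq_mul, creatFirst, hadj]

theorem norm_annihLevel_le : ‖annihLevel P n‖ ≤ √√((n : ℝ) + 1) := by
  refine ContinuousLinearMap.opNorm_le_bound _ (by positivity) fun g => ?_
  have hadj : ‖(creatFirst P n).adjoint g‖ ≤ √(1 / (4 * √((n : ℝ) + 2))) * ‖g‖ := by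
    refine ContinuousLinearMap.le_of_opNorm_le _ ?_ (g : L2n (n + 1))
    rw [LinearIsometryEquiv.norm_map]
    exact (isBoundedWeight_creatWeight P n).norm_weightedComp_le
  have hconst : √((n : ℝ) + 1) * √(1 / (4 * √((n : ℝ) + 2))) ≤ √√((n : ℝ) + 1) := by
    rw [← Real.sqrt_mul (by positivity)]
    refine Real.sqrt_le_sqrt ?_
    rw [mul_one_div, div_le_iff₀ (by positivity)]
    have hle : √((n : ℝ) + 1) ≤ 4 * √((n : ℝ) + 2) :=
      (Real.sqrt_le_sqrt (by linarith)).trans (le_mul_of_one_le_left (by positivity) (by norm_num))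
    calc (n : ℝ) + 1 = √((n : ℝ) + 1) * √((n : ℝ) + 1) := (Real.mul_self_sqrt (by positivity)).symm
      _ ≤ √((n : ℝ) + 1) * (4 * √((n : ℝ) + 2)) := by gcongr
  calc ‖annihLevel P n g‖ = √((n : ℝ) + 1) * ‖(creatFirst P n).adjoint g‖ := by
        rw [annihLevel, smul_apply, norm_smul, Complex.norm_real,
          Real.norm_of_nonneg (by positivity)]
        rfl
    _ ≤ √((n : ℝ) + 1) * (√(1 / (4 * √((n : ℝ) + 2))) * ‖g‖) := by gcongr
    _ ≤ √√((n : ℝ) + 1) * ‖g‖ := by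
        rw [← mul_assoc]
        gcongr

variable {n}

theorem sum_permAct_creatFirst_mem_bosons (f : bosons n) :
    ∑ j : Fin (n + 1), permAct j.cycleRange.symm (creatFirst P n f) ∈ bosons (n + 1) :=
  fun σ => by
    have hmove : ∀ j : Fin (n + 1), permAct σ (permAct j.cycleRange.symm (creatFirst P n f))
        = permAct (σ j).cycleRange.symm (creatFirst P n f) := fun j => by
      rw [← permAct_mul]
      exact permAct_creatFirst_congr P f (by simp)
    simp only [map_sum, hmove]
    exact Equiv.sum_comp σ fun j => permAct j.cycleRange.symm (creatFirst P n f)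

/-- `H₀^{-1/2}a*(v)` from the `n`-particle to the `(n + 1)`-particle component; the cycle
`j.cycleRange.symm` moves the `j`-th momentum to the first slot, keeping the order of the others. -/
def creatLevel (f : bosons n) : bosons (n + 1) :=
  (((√((n : ℝ) + 1))⁻¹ : ℝ) : ℂ) •
    ⟨∑ j : Fin (n + 1), permAct j.cycleRange.symm (creatFirst P n f),
      sum_permAct_creatFirst_mem_bosons P f⟩

theorem adjoint_annihLevel (f : bosons n) : (annihLevel P n).adjoint f = creatLevel P f := by
  refine ext_inner_left ℂ fun g => ?_
  have hn : (((√((n : ℝ) + 1))⁻¹ : ℝ) : ℂ) * ((n + 1 : ℕ) : ℂ) = (√((n : ℝ) + 1) : ℝ) := by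
    rw [← Complex.ofReal_natCast, ← Complex.ofReal_mul, Nat.cast_succ, inv_mul_eq_div,
      Real.div_sqrt]
  calc inner ℂ g ((annihLevel P n).adjoint f)
      = ((√((n : ℝ) + 1) : ℝ) : ℂ) * inner ℂ (g : L2n (n + 1)) (creatFirst P n f) := by
        rw [ContinuousLinearMap.adjoint_inner_right, annihLevel, smul_apply,
          inner_smul_left, Complex.conj_ofReal]
        exact congrArg _ (ContinuousLinearMap.adjoint_inner_left _ (f : L2n n) (g : L2n (n + 1)))
    _ = (((√((n : ℝ) + 1))⁻¹ : ℝ) : ℂ) * ∑ j : Fin (n + 1),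
          inner ℂ (g : L2n (n + 1)) (permAct j.cycleRange.symm (creatFirst P n f)) := by
        simp only [inner_permAct_bosons, Finset.sum_const, Finset.card_univ, Fintype.card_fin,
          nsmul_eq_mul]
        rw [← mul_assoc, hn]
    _ = inner ℂ g (creatLevel P f) := by
        rw [← inner_sum, ← inner_smul_right]
        rfl

theorem creatLevel_coe (Ψ : Fock) (n : ℕ) :
    (creatLevel P (Ψ n) : L2n (n + 1))
      =ᵐ[volume] fun k => (invSqrtEnergy P (n + 1) k : ℂ) * creat Ψ (n + 1) k := by
  have hterm : ∀ᵐ k : Fin (n + 1) → R3, ∀ j : Fin (n + 1),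
      permAct j.cycleRange.symm (creatFirst P n (Ψ n : L2n n)) k
        = (invSqrtEnergy P (n + 1) k : ℂ) * ((vhat (k j) : ℂ) * comp Ψ n (k ∘ j.succAbove)) := by
    refine ae_all_iff.2 fun j => ?_
    filter_upwards [permAct_coe j.cycleRange.symm (creatFirst P n (Ψ n : L2n n)),
      ae_comp_perm j.cycleRange.symm (creatFirst_coe P n (Ψ n : L2n n))] with k hperm hcreat
    have htail : Fin.tail (k ∘ j.cycleRange.symm) = k ∘ j.succAbove := by
      funext i
      simp [Fin.tail]
    rw [hperm, hcreat, creatWeight, invSqrtEnergy_comp_perm, htail, Function.comp_apply,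
      Fin.cycleRange_symm_zero, Complex.ofReal_mul, mul_assoc]
    rfl
  filter_upwards [hterm, Lp.coeFn_smul (((√((n : ℝ) + 1))⁻¹ : ℝ) : ℂ)
      (∑ j : Fin (n + 1), permAct j.cycleRange.symm (creatFirst P n (Ψ n : L2n n))),
    Lp.coeFn_finsetSum _ fun j : Fin (n + 1) =>
      permAct j.cycleRange.symm (creatFirst P n (Ψ n : L2n n))] with k hk hsmul hsum
  refine hsmul.trans ?_
  rw [Pi.smul_apply, hsum, Finset.sum_apply, Finset.sum_congr rfl fun j _ => hk j,
    ← Finset.mul_sum, smul_eq_mul, mul_left_comm]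
  rfl

end Levels

/-! ### The operators on Fock space -/

theorem norm_comp_le_of_le {E₁ E₂ E₃ : Type*} [SeminormedAddCommGroup E₁] [NormedSpace ℂ E₁]
    [SeminormedAddCommGroup E₂] [NormedSpace ℂ E₂] [SeminormedAddCommGroup E₃] [NormedSpace ℂ E₃]
    {A : E₂ →L[ℂ] E₃} {B : E₁ →L[ℂ] E₂} {a b : ℝ} (hA : ‖A‖ ≤ a) (hB : ‖B‖ ≤ b) :
    ‖A ∘L B‖ ≤ a * b :=
  (A.opNorm_comp_le B).trans
    (mul_le_mul hA hB (norm_nonneg _) ((norm_nonneg _).trans hA))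

section FockOperators

variable (P : R3)

theorem one_le_sqrt_natCast_add_one (n : ℕ) : 1 ≤ √((n : ℝ) + 1) :=
  Real.one_le_sqrt.2 (le_add_of_nonneg_left n.cast_nonneg)

theorem norm_invSqrtLevel_le_one (n : ℕ) : ‖invSqrtLevel P n‖ ≤ 1 :=
  (norm_invSqrtLevel_le P n).trans (inv_le_one_of_one_le₀ (one_le_sqrt_natCast_add_one n))

theorem norm_annihLevel_comp_invSqrtLevel_le (n : ℕ) :
    ‖annihLevel P n ∘L invSqrtLevel P (n + 1)‖ ≤ (√√(((n + 1 : ℕ) : ℝ) + 1))⁻¹ := by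
  have hann : ‖annihLevel P n‖ ≤ √√(((n + 1 : ℕ) : ℝ) + 1) :=
    (norm_annihLevel_le P n).trans (by gcongr; simp)
  refine (norm_comp_le_of_le hann (norm_invSqrtLevel_le P (n + 1))).trans_eq ?_
  rw [← Real.mul_self_sqrt (Real.sqrt_nonneg (((n + 1 : ℕ) : ℝ) + 1)), mul_inv,
    Real.mul_self_sqrt (Real.sqrt_nonneg _), mul_inv_cancel_left₀ (by positivity)]

theorem norm_annihLevel_comp_invSqrtLevel_le_one (n : ℕ) :
    ‖annihLevel P n ∘L invSqrtLevel P (n + 1)‖ ≤ 1 :=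
  (norm_annihLevel_comp_invSqrtLevel_le P n).trans <| inv_le_one_of_one_le₀ <|
    Real.one_le_sqrt.2 (one_le_sqrt_natCast_add_one (n + 1))

theorem norm_annihLevel_comp_invSqrtLevel_comp_annihLevel_le_one (n : ℕ) :
    ‖(annihLevel P n ∘L invSqrtLevel P (n + 1)) ∘L annihLevel P (n + 1)‖ ≤ 1 :=
  (norm_comp_le_of_le (norm_annihLevel_comp_invSqrtLevel_le P n)
    (norm_annihLevel_le P (n + 1))).trans_eq (inv_mul_cancel₀ (by positivity))

theorem norm_invSqrtLevel_comp_annihLevel_le_one (n : ℕ) :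
    ‖invSqrtLevel P n ∘L annihLevel P n‖ ≤ 1 := by
  have hann : ‖annihLevel P n‖ ≤ √((n : ℝ) + 1) := (norm_annihLevel_le P n).trans <|
    Real.sqrt_le_self_iff.2 (Or.inr (one_le_sqrt_natCast_add_one n))
  exact (norm_comp_le_of_le (norm_invSqrtLevel_le P n) hann).trans_eq
    (inv_mul_cancel₀ (by positivity))

theorem norm_annihLevel_comp_adjoint_comp_invSqrtLevel_le_one (n : ℕ) :
    ‖annihLevel P n ∘L (annihLevel P n).adjoint ∘L invSqrtLevel P n‖ ≤ 1 := by
  have hadj : ‖(annihLevel P n).adjoint‖ ≤ √√((n : ℝ) + 1) :=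
    (LinearIsometryEquiv.norm_map _ _).trans_le (norm_annihLevel_le P n)
  refine (norm_comp_le_of_le (norm_annihLevel_le P n)
    (norm_comp_le_of_le hadj (norm_invSqrtLevel_le P n))).trans_eq ?_
  rw [← mul_assoc, Real.mul_self_sqrt (Real.sqrt_nonneg _), mul_inv_cancel₀ (by positivity)]

/-- The bounded operator `H₀^{-1/2}`. -/
def invSqrtH0 : Fock →L[ℂ] Fock :=
  hilbertSumMap (.refl ℕ) (invSqrtLevel P) ⟨1, norm_invSqrtLevel_le_one P⟩

/-- The bounded operator `a(v)H₀⁻¹`. -/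
def annihInvH0 : Fock →L[ℂ] Fock :=
  hilbertSumMap (addRightEmbedding 1) (fun n => annihLevel P n ∘L invSqrtLevel P (n + 1))
    ⟨1, norm_annihLevel_comp_invSqrtLevel_le_one P⟩

/-- The bounded operator `H₀^{-1/2}a(v)H₀^{-1/2}`. -/
def conjAnnih : Fock →L[ℂ] Fock :=
  hilbertSumMap (addRightEmbedding 1) (fun n => invSqrtLevel P n ∘L annihLevel P n)
    ⟨1, norm_invSqrtLevel_comp_annihLevel_le_one P⟩

/-- The bounded operator `a(v)H₀⁻¹a(v)H₀^{-1/2}`. -/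
def annihInvH0Annih : Fock →L[ℂ] Fock :=
  hilbertSumMap (addRightEmbedding 2)
    (fun n => (annihLevel P n ∘L invSqrtLevel P (n + 1)) ∘L annihLevel P (n + 1))
    ⟨1, norm_annihLevel_comp_invSqrtLevel_comp_annihLevel_le_one P⟩

/-- The bounded operator `a(v)H₀⁻¹a*(v)H₀^{-1/2}`. -/
def annihInvH0Creat : Fock →L[ℂ] Fock :=
  hilbertSumMap (.refl ℕ)
    (fun n => annihLevel P n ∘L (annihLevel P n).adjoint ∘L invSqrtLevel P n)
    ⟨1, norm_annihLevel_comp_adjoint_comp_invSqrtLevel_le_one P⟩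

theorem adjoint_conjAnnih_apply_succ (Ψ : Fock) (n : ℕ) :
    (conjAnnih P).adjoint Ψ (n + 1) = (annihLevel P n).adjoint (invSqrtLevel P n (Ψ n)) := by
  have hlevel : (conjAnnih P).adjoint Ψ (n + 1)
      = (invSqrtLevel P n ∘L annihLevel P n).adjoint (Ψ n) :=
    adjoint_hilbertSumMap_apply (h := fun n => bosons n) (h' := fun n => bosons n)
      (τ := addRightEmbedding 1) (t := fun n => invSqrtLevel P n ∘L annihLevel P n)
      ⟨1, norm_invSqrtLevel_comp_annihLevel_le_one P⟩ Ψ n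
  rw [hlevel, ContinuousLinearMap.adjoint_comp, (isSelfAdjoint_invSqrtLevel P n).adjoint_eq,
    ContinuousLinearMap.comp_apply]

theorem adjoint_annihInvH0_apply_succ (Ψ : Fock) (n : ℕ) :
    (annihInvH0 P).adjoint Ψ (n + 1) = invSqrtLevel P (n + 1) (creatLevel P (Ψ n)) := by
  have hlevel : (annihInvH0 P).adjoint Ψ (n + 1)
      = (annihLevel P n ∘L invSqrtLevel P (n + 1)).adjoint (Ψ n) :=
    adjoint_hilbertSumMap_apply (h := fun n => bosons n) (h' := fun n => bosons n)
      (τ := addRightEmbedding 1) (t := fun n => annihLevel P n ∘L invSqrtLevel P (n + 1))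
      ⟨1, norm_annihLevel_comp_invSqrtLevel_le_one P⟩ Ψ n
  rw [hlevel, ContinuousLinearMap.adjoint_comp, (isSelfAdjoint_invSqrtLevel P (n + 1)).adjoint_eq,
    ContinuousLinearMap.comp_apply, adjoint_annihLevel]

theorem adjoint_annihInvH0_apply_zero (Ψ : Fock) : (annihInvH0 P).adjoint Ψ 0 = 0 :=
  adjoint_hilbertSumMap_apply_of_notMem_range _ Ψ (by simp)

theorem isSelfAdjoint_invSqrtH0 : IsSelfAdjoint (invSqrtH0 P) := by
  refine ContinuousLinearMap.ext fun Ψ => lp.ext (funext fun n => ?_)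
  have hlevel : (invSqrtH0 P).adjoint Ψ n = (invSqrtLevel P n).adjoint (Ψ n) :=
    adjoint_hilbertSumMap_apply (h := fun n => bosons n) (h' := fun n => bosons n)
      (τ := .refl ℕ) (t := invSqrtLevel P) ⟨1, norm_invSqrtLevel_le_one P⟩ Ψ n
  rw [(isSelfAdjoint_invSqrtLevel P n).adjoint_eq] at hlevel
  exact hlevel

theorem injective_invSqrtH0 : Function.Injective (invSqrtH0 P) := fun _ _ hfg =>
  lp.ext <| funext fun n => injective_invSqrtLevel P n (congrFun (congrArg (⇑) hfg) n)

theorem regularizedAnnihilation :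
    RegularizedAnnihilation (invSqrtH0 P) (conjAnnih P) (annihInvH0 P) (annihInvH0Annih P)
      (annihInvH0Creat P) where
  isSelfAdjoint := isSelfAdjoint_invSqrtH0 P
  injective := injective_invSqrtH0 P
  outer_comp_F := ContinuousLinearMap.ext fun _ => lp.ext <| funext fun _ => rfl
  outer_comp_V := ContinuousLinearMap.ext fun _ => lp.ext <| funext fun _ => rfl
  outer_comp_W := ContinuousLinearMap.ext fun Ψ => lp.ext <| funext fun n =>
    congrArg (fun x => invSqrtLevel P n (annihLevel P n x))
      (adjoint_conjAnnih_apply_succ P Ψ n).symm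

end FockOperators

/-! ### Graphs of composite operators -/

section Graphs

variable {E : Type*} [AddCommGroup E] [Module ℂ E]

theorem mem_graph_iff_exists_mem_domain (f : E →ₗ.[ℂ] E) (x y : E) :
    (x, y) ∈ f.graph ↔ ∃ hx : x ∈ f.domain, f ⟨x, hx⟩ = y := by
  rw [LinearPMap.mem_graph_iff, Subtype.exists]
  simp only [exists_and_left]
  exact ⟨fun ⟨_, hz, hx, hy⟩ => hz ▸ ⟨hx, hy⟩, fun ⟨hx, hy⟩ => ⟨x, rfl, hx, hy⟩⟩

theorem mem_graph_pcomp_iff (g f : E →ₗ.[ℂ] E) (x z : E) :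
    (x, z) ∈ (pcomp g f).graph ↔ ∃ y, (x, y) ∈ f.graph ∧ (y, z) ∈ g.graph := by
  simp only [mem_graph_iff_exists_mem_domain, mem_pcomp_domain]
  constructor
  · rintro ⟨⟨hx, hy⟩, hz⟩
    exact ⟨f ⟨x, hx⟩, ⟨hx, rfl⟩, hy, hz⟩
  · rintro ⟨y, ⟨hx, rfl⟩, hy, hz⟩
    exact ⟨⟨hx, hy⟩, hz⟩

theorem mem_graph_add_iff (f g : E →ₗ.[ℂ] E) (x z : E) :
    (x, z) ∈ (f + g).graph ↔ ∃ a b, (x, a) ∈ f.graph ∧ (x, b) ∈ g.graph ∧ a + b = z := by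
  simp only [mem_graph_iff_exists_mem_domain]
  constructor
  · rintro ⟨⟨hf, hg⟩, hz⟩
    exact ⟨_, _, ⟨hf, rfl⟩, ⟨hg, rfl⟩, hz⟩
  · rintro ⟨_, _, ⟨hf, rfl⟩, ⟨hg, rfl⟩, hz⟩
    exact ⟨⟨hf, hg⟩, hz⟩

theorem mem_graph_smul_iff (c : ℂ) (f : E →ₗ.[ℂ] E) (x z : E) :
    (x, z) ∈ (c • f).graph ↔ ∃ y, (x, y) ∈ f.graph ∧ c • y = z := by
  simp only [mem_graph_iff_exists_mem_domain]
  exact ⟨fun ⟨hx, hz⟩ => ⟨_, ⟨hx, rfl⟩, hz⟩, fun ⟨_, ⟨hx, rfl⟩, hz⟩ => ⟨hx, hz⟩⟩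

theorem mem_graph_neg_iff (f : E →ₗ.[ℂ] E) (x z : E) :
    (x, z) ∈ (-f).graph ↔ ∃ y, (x, y) ∈ f.graph ∧ -y = z := by
  simp only [mem_graph_iff_exists_mem_domain]
  exact ⟨fun ⟨hx, hz⟩ => ⟨_, ⟨hx, rfl⟩, hz⟩, fun ⟨_, ⟨hx, rfl⟩, hz⟩ => ⟨hx, hz⟩⟩

theorem mem_graph_pone_iff (x z : E) : (x, z) ∈ (pone : E →ₗ.[ℂ] E).graph ↔ x = z := by
  rw [mem_graph_iff_exists_mem_domain]
  exact ⟨fun ⟨_, h⟩ => h, fun h => ⟨Submodule.mem_top, h⟩⟩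

theorem mem_graph_pone_add_smul_iff (c : ℂ) (f : E →ₗ.[ℂ] E) (x z : E) :
    (x, z) ∈ (pone + c • f).graph ↔ ∃ y, (x, y) ∈ f.graph ∧ z = x + c • y := by
  simp only [mem_graph_add_iff, mem_graph_pone_iff, mem_graph_smul_iff]
  constructor
  · rintro ⟨_, _, rfl, ⟨y, hy, rfl⟩, rfl⟩
    exact ⟨y, hy, rfl⟩
  · rintro ⟨y, hy, rfl⟩
    exact ⟨x, _, rfl, ⟨y, hy, rfl⟩, rfl⟩

end Graphs

/-! ### The Hamiltonian through bounded operators -/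

section Hamiltonian

variable (α : ℝ) (P : R3)

theorem fock_eq_iff_comp_ae (Ψ Φ : Fock) : Ψ = Φ ↔ ∀ n, ∀ᵐ k, comp Ψ n k = comp Φ n k :=
  ⟨fun h n => by rw [h]; exact Eventually.of_forall fun _ => rfl,
    fun h => lp.ext <| funext fun n => bosons_ext (h n)⟩

theorem mem_graph_multOp_iff (w : ∀ n : ℕ, (Fin n → R3) → ℝ) (Ψ Φ : Fock) :
    (Ψ, Φ) ∈ (multOp w).graph ↔ ∀ n, ∀ᵐ k, comp Φ n k = (w n k : ℂ) * comp Ψ n k := by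
  rw [multOp, Submodule.toLinearPMap_graph_eq _ (multGraph_singleValued w)]
  rfl

theorem comp_invSqrtH0 (g : Fock) (n : ℕ) :
    comp (invSqrtH0 P g) n =ᵐ[volume] fun k => (invSqrtEnergy P n k : ℂ) * comp g n k :=
  invSqrtLevel_coe P n (g n)

theorem comp_invSqrtH0_invSqrtH0 (X : Fock) (n : ℕ) :
    comp (invSqrtH0 P (invSqrtH0 P X)) n
      =ᵐ[volume] fun k => ((energy P n k)⁻¹ : ℝ) * comp X n k := by
  filter_upwards [comp_invSqrtH0 P (invSqrtH0 P X) n, comp_invSqrtH0 P X n] with k houter hinner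
  rw [houter, hinner, ← mul_assoc, ← Complex.ofReal_mul, ← pow_two, invSqrtEnergy_sq]

theorem mem_graph_H0sqrt_iff (Ψ g : Fock) :
    (Ψ, g) ∈ (H0sqrt P).graph ↔ invSqrtH0 P g = Ψ := by
  rw [H0sqrt, mem_graph_multOp_iff, fock_eq_iff_comp_ae]
  refine forall_congr' fun n => eventually_congr ?_
  filter_upwards [comp_invSqrtH0 P g n] with k hk
  have hne : ((√(energy P n k) : ℝ) : ℂ) ≠ 0 :=
    Complex.ofReal_ne_zero.2 (Real.sqrt_pos.2 (energy_pos P n k)).ne'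
  rw [hk, invSqrtEnergy, Complex.ofReal_inv, inv_mul_eq_iff_eq_mul₀ hne]

theorem mem_graph_H0inv_iff (X Ψ : Fock) :
    (X, Ψ) ∈ (H0inv P).graph ↔ Ψ = invSqrtH0 P (invSqrtH0 P X) := by
  rw [H0inv, mem_graph_multOp_iff, fock_eq_iff_comp_ae]
  refine forall_congr' fun n => eventually_congr ?_
  filter_upwards [comp_invSqrtH0_invSqrtH0 P X n] with k hk
  rw [hk]

theorem mem_graph_H0_iff (Ψ X : Fock) :
    (Ψ, X) ∈ (H0 P).graph ↔ Ψ = invSqrtH0 P (invSqrtH0 P X) := by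
  rw [H0, mem_graph_multOp_iff, fock_eq_iff_comp_ae]
  refine forall_congr' fun n => eventually_congr ?_
  filter_upwards [comp_invSqrtH0_invSqrtH0 P X n] with k hk
  have hne : ((energy P n k : ℝ) : ℂ) ≠ 0 := Complex.ofReal_ne_zero.2 (energy_pos P n k).ne'
  rw [hk, Complex.ofReal_inv, eq_inv_mul_iff_mul_eq₀ hne, eq_comm]

theorem annihIntegrand_invSqrtH0 (g : Fock) (n : ℕ) : ∀ᵐ k : Fin n → R3,
    (fun ξ : R3 => (vhat ξ : ℂ) * comp (invSqrtH0 P g) (n + 1) (Fin.cons ξ k))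
      =ᵐ[volume] fun ξ => (creatWeight P n (Fin.cons ξ k) : ℂ) *
        (g (n + 1) : L2n (n + 1)) (Fin.cons ξ k) := by
  filter_upwards [ae_cons (comp_invSqrtH0 P g (n + 1))] with k hk
  filter_upwards [hk] with ξ hξ
  rw [hξ, creatWeight, Fin.cons_zero, Complex.ofReal_mul, mul_left_comm, mul_assoc]
  rfl

theorem annihConv_invSqrtH0 (g : Fock) : AnnihConv (invSqrtH0 P g) := fun n => by
  filter_upwards [annihIntegrand_invSqrtH0 P g n,
    (isBoundedWeight_creatWeight P n).ae_integrable_cons (g (n + 1) : L2n (n + 1))]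
    with k hk hint
  exact hint.congr hk.symm

theorem annih_invSqrtH0_ae_eq (g : Fock) (n : ℕ) :
    annih (invSqrtH0 P g) n =ᵐ[volume] (annihLevel P n (g (n + 1)) : L2n n) := by
  filter_upwards [annihIntegrand_invSqrtH0 P g n, annihLevel_coe P n (g (n + 1))] with k hk hlevel
  rw [hlevel, annih, integral_congr_ae hk]

theorem invSqrtH0_mem_graph_annihOp_iff (g Φ : Fock) :
    (invSqrtH0 P g, Φ) ∈ annihOp.graph ↔ invSqrtH0 P Φ = conjAnnih P g := by
  have hlevel : invSqrtH0 P Φ = conjAnnih P g ↔ ∀ n, Φ n = annihLevel P n (g (n + 1)) := by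
    rw [lp.ext_iff, funext_iff]
    exact forall_congr' fun n => (injective_invSqrtLevel P n).eq_iff
  rw [annihOp, Submodule.toLinearPMap_graph_eq _ annihGraph_singleValued, hlevel]
  refine (and_iff_right (annihConv_invSqrtH0 P g)).trans (forall_congr' fun n => ?_)
  have hcongr : comp Φ n =ᵐ[volume] annih (invSqrtH0 P g) n ↔
      comp Φ n =ᵐ[volume] (annihLevel P n (g (n + 1)) : L2n n) :=
    ⟨fun h => h.trans (annih_invSqrtH0_ae_eq P g n),
      fun h => h.trans (annih_invSqrtH0_ae_eq P g n).symm⟩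
  exact hcongr.trans ⟨bosons_ext, fun h => by rw [← h]; rfl⟩

theorem comp_adjoint_annihInvH0 (Ψ : Fock) (n : ℕ) :
    comp ((annihInvH0 P).adjoint Ψ) n
      =ᵐ[volume] fun k => ((energy P n k)⁻¹ : ℝ) * creat Ψ n k := by
  cases n with
  | zero =>
    have hzero : comp ((annihInvH0 P).adjoint Ψ) 0 =ᵐ[volume] 0 := by
      rw [comp, adjoint_annihInvH0_apply_zero]
      exact Lp.coeFn_zero _ _ _
    filter_upwards [hzero] with k hk
    rw [hk, creat, mul_zero, Pi.zero_apply]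
  | succ n =>
    rw [comp, adjoint_annihInvH0_apply_succ]
    filter_upwards [invSqrtLevel_coe P (n + 1) (creatLevel P (Ψ n)), creatLevel_coe P Ψ n]
      with k houter hinner
    rw [houter, hinner, ← mul_assoc, ← Complex.ofReal_mul, ← pow_two, invSqrtEnergy_sq]

theorem mem_graph_H0invCreat_iff (Ψ Φ : Fock) :
    (Ψ, Φ) ∈ (H0invCreat P).graph ↔ Φ = (annihInvH0 P).adjoint Ψ := by
  rw [H0invCreat, Submodule.toLinearPMap_graph_eq _ (H0invCreatGraph_singleValued P),
    fock_eq_iff_comp_ae]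
  refine forall_congr' fun n => eventually_congr ?_
  filter_upwards [comp_adjoint_annihInvH0 P Ψ n] with k hk
  rw [hk]

theorem mem_graph_annihOp_H0inv_iff (X Z : Fock) :
    (X, Z) ∈ (pcomp annihOp (H0inv P)).graph ↔ Z = annihInvH0 P X := by
  simp only [mem_graph_pcomp_iff, mem_graph_H0inv_iff, exists_eq_left,
    invSqrtH0_mem_graph_annihOp_iff]
  rw [← (regularizedAnnihilation P).outer_F_apply, (injective_invSqrtH0 P).eq_iff]

theorem invSqrtH0_mem_graph_annihOp_H0invCreat_iff (g Y : Fock) :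
    (invSqrtH0 P g, Y) ∈ (pcomp annihOp (H0invCreat P)).graph ↔ Y = annihInvH0Creat P g := by
  simp only [mem_graph_pcomp_iff, mem_graph_H0invCreat_iff, exists_eq_left]
  rw [(regularizedAnnihilation P).F_adjoint_outer_apply, invSqrtH0_mem_graph_annihOp_iff,
    ← (regularizedAnnihilation P).outer_W_apply, (injective_invSqrtH0 P).eq_iff]

theorem domain_annihOp_H0inv : (pcomp annihOp (H0inv P)).domain = ⊤ :=
  Submodule.eq_top_iff'.2 fun X =>
    LinearPMap.mem_domain_iff.2 ⟨_, (mem_graph_annihOp_H0inv_iff P X _).2 rfl⟩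

theorem domain_H0invCreat : (H0invCreat P).domain = ⊤ :=
  Submodule.eq_top_iff'.2 fun Ψ =>
    LinearPMap.mem_domain_iff.2 ⟨_, (mem_graph_H0invCreat_iff P Ψ _).2 rfl⟩

theorem mem_graph_H0_rightFactor_iff (Ψ X : Fock) :
    (Ψ, X) ∈ (pcomp (H0 P) (rightFactor α P)).graph ↔
      Ψ + ((√α : ℝ) : ℂ) • (annihInvH0 P).adjoint Ψ = invSqrtH0 P (invSqrtH0 P X) := by
  simp only [mem_graph_pcomp_iff, rightFactor, mem_graph_pone_add_smul_iff,
    mem_graph_H0invCreat_iff, exists_eq_left, mem_graph_H0_iff]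

theorem mem_graph_K_iff (Ψ Z : Fock) :
    (Ψ, Z) ∈ (K α P).graph ↔ ∃ X, (Ψ, X) ∈ (pcomp (H0 P) (rightFactor α P)).graph ∧
      Z = X + ((√α : ℝ) : ℂ) • annihInvH0 P X := by
  rw [K, mem_graph_pcomp_iff]
  simp only [leftFactor, mem_graph_pone_add_smul_iff, mem_graph_annihOp_H0inv_iff, exists_eq_left]

theorem invSqrtH0_mem_graph_T_iff (g Y : Fock) :
    (invSqrtH0 P g, Y) ∈ (T α P).graph ↔ -((α : ℂ) • annihInvH0Creat P g) = Y := by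
  simp only [T, mem_graph_neg_iff, mem_graph_smul_iff, invSqrtH0_mem_graph_annihOp_H0invCreat_iff,
    exists_eq_left, exists_eq_left']

variable {α}

theorem mem_graph_K_add_T_iff (hα : 0 ≤ α) (Ψ η : Fock) :
    (Ψ, η) ∈ (K α P + T α P).graph ↔
      ∃ g, invSqrtH0 P g = Ψ ∧ sandwiched (conjAnnih P) √α g = invSqrtH0 P η := by
  have hsq : (α : ℂ) = ((√α : ℝ) : ℂ) * ((√α : ℝ) : ℂ) := by
    rw [← Complex.ofReal_mul, Real.mul_self_sqrt hα]
  have hsum : ∀ X g : Fock, X + ((√α : ℝ) : ℂ) • annihInvH0 P X + -((α : ℂ) • annihInvH0Creat P g)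
      = X + ((√α : ℝ) : ℂ) • (annihInvH0 P X - ((√α : ℝ) : ℂ) • annihInvH0Creat P g) := by
    intro X g
    rw [hsq]
    module
  simp only [mem_graph_add_iff, mem_graph_K_iff, mem_graph_H0_rightFactor_iff,
    (regularizedAnnihilation P).exists_preimage_iff,
    (regularizedAnnihilation P).sandwiched_eq_outer_iff]
  constructor
  · rintro ⟨_, Y, ⟨X, ⟨g, rfl, hX⟩, rfl⟩, hY, rfl⟩
    obtain rfl := (invSqrtH0_mem_graph_T_iff α P g Y).1 hY
    exact ⟨g, rfl, X, hX, hsum X g⟩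
  · rintro ⟨g, rfl, X, hX, rfl⟩
    exact ⟨_, _, ⟨X, ⟨g, rfl, hX⟩, rfl⟩, (invSqrtH0_mem_graph_T_iff α P g _).2 rfl, hsum X g⟩

theorem mem_domain_K_add_T_iff (hα : 0 ≤ α) (Ψ : Fock) :
    Ψ ∈ (K α P + T α P).domain ↔ Ψ ∈ (pcomp (H0 P) (rightFactor α P)).domain := by
  simp only [LinearPMap.mem_domain_iff, mem_graph_K_add_T_iff P hα, mem_graph_H0_rightFactor_iff,
    (regularizedAnnihilation P).exists_preimage_iff,
    (regularizedAnnihilation P).sandwiched_eq_outer_iff]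
  constructor
  · rintro ⟨_, g, hg, X, hX, -⟩
    exact ⟨X, g, hg, hX⟩
  · rintro ⟨X, g, hg, hX⟩
    exact ⟨_, g, hg, X, hX, rfl⟩

theorem mem_formDomain_iff (Ψ : Fock) : Ψ ∈ formDomain P ↔ ∃ g, invSqrtH0 P g = Ψ := by
  simp only [formDomain, LinearPMap.mem_domain_iff, mem_graph_H0sqrt_iff]

theorem interactionTerm_invSqrtH0 (g : Fock) (n : ℕ) :
    interactionTerm (invSqrtH0 P g) n = inner ℂ (g n) (conjAnnih P g n) := by
  calc interactionTerm (invSqrtH0 P g) n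
      = inner ℂ (invSqrtLevel P n (g n)) (annihLevel P n (g (n + 1))) := by
        rw [Submodule.coe_inner, L2.inner_def, interactionTerm]
        refine integral_congr_ae ?_
        filter_upwards [annih_invSqrtH0_ae_eq P g n] with k hk
        rw [hk, RCLike.inner_apply, mul_comm]
        rfl
    _ = inner ℂ (g n) (conjAnnih P g n) :=
        (isSelfAdjoint_invSqrtLevel P n).isSymmetric.apply_clm _ _

theorem Q_eq_re_inner_sandwiched (Ψ : formDomain P) (g : Fock) (hg : invSqrtH0 P g = Ψ) :
    Q α P Ψ = (inner ℂ g (sandwiched (conjAnnih P) √α g)).re := by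
  have hsqrt : H0sqrt P Ψ = g :=
    ((mem_graph_iff_exists_mem_domain _ _ _).1 ((mem_graph_H0sqrt_iff P Ψ g).2 hg)).2
  rw [re_inner_sandwiched, Q, hsqrt, ← hg, lp.inner_eq_tsum]
  simp only [interactionTerm_invSqrtH0]

theorem memLp_annih_of_mem_formDomain {Ψ : Fock} (hΨ : Ψ ∈ formDomain P) (n : ℕ) :
    MemLp (annih Ψ n) 2 volume := by
  obtain ⟨g, rfl⟩ := (mem_formDomain_iff P Ψ).1 hΨ
  exact (memLp_congr_ae (annih_invSqrtH0_ae_eq P g n)).2 (Lp.memLp _)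

theorem annihConv_of_mem_formDomain {Ψ : Fock} (hΨ : Ψ ∈ formDomain P) : AnnihConv Ψ := by
  obtain ⟨g, rfl⟩ := (mem_formDomain_iff P Ψ).1 hΨ
  exact annihConv_invSqrtH0 P g

theorem summable_interactionTerm_of_mem_formDomain {Ψ : Fock} (hΨ : Ψ ∈ formDomain P) :
    Summable (interactionTerm Ψ) := by
  obtain ⟨g, rfl⟩ := (mem_formDomain_iff P Ψ).1 hΨ
  exact (lp.summable_inner g (conjAnnih P g)).congr fun n => (interactionTerm_invSqrtH0 P g n).symm

theorem isFormOf_Q (hα : 0 ≤ α) : IsFormOf (formDomain P) (Q α P) (K α P + T α P) :=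
  (regularizedAnnihilation P).isFormOf_sandwiched (mem_graph_K_add_T_iff P hα)
    (mem_formDomain_iff P) (Q_eq_re_inner_sandwiched P)

end Hamiltonian

end Froehlich

end

/-- For `α > 0` and `P ∈ ℝ³`: the operators `a(v)H₀⁻¹` and `H₀⁻¹a*(v)` are everywhere defined; the
form `Q_P` is well defined on `D(H₀^{1/2})` (all integrals and sums converge absolutely);
`K(P) + T(P)` has domain `{Ψ | (1 + √α H₀⁻¹a*(v))Ψ ∈ D(H₀)}`; and `K(P) + T(P)` is a self-adjoint
operator whose form is `Q_P`. -/
theorem propositionA1 (α : ℝ) (hα : 0 < α) (P : Froehlich.R3) :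
    (Froehlich.pcomp Froehlich.annihOp (Froehlich.H0inv P)).domain = ⊤ ∧
    (Froehlich.H0invCreat P).domain = ⊤ ∧
    (∀ Ψ ∈ Froehlich.formDomain P,
      Froehlich.AnnihConv Ψ ∧
      (∀ n : ℕ, MeasureTheory.MemLp (Froehlich.annih Ψ n) 2 MeasureTheory.volume) ∧
      Summable (Froehlich.interactionTerm Ψ)) ∧
    (∀ Ψ : Froehlich.Fock, Ψ ∈ (Froehlich.K α P + Froehlich.T α P).domain ↔
      ∃ hΨ : Ψ ∈ (Froehlich.rightFactor α P).domain,
        Froehlich.rightFactor α P ⟨Ψ, hΨ⟩ ∈ (Froehlich.H0 P).domain) ∧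
    Froehlich.IsFormOf (Froehlich.formDomain P) (Froehlich.Q α P)
      (Froehlich.K α P + Froehlich.T α P) := by
  exact ⟨Froehlich.domain_annihOp_H0inv P, Froehlich.domain_H0invCreat P,
    fun Ψ hΨ => ⟨Froehlich.annihConv_of_mem_formDomain P hΨ,
      Froehlich.memLp_annih_of_mem_formDomain P hΨ,
      Froehlich.summable_interactionTerm_of_mem_formDomain P hΨ⟩,
    fun Ψ => (Froehlich.mem_domain_K_add_T_iff P hα.le Ψ).trans
      (Froehlich.mem_pcomp_domain _ _ Ψ),
    Froehlich.isFormOf_Q P hα.le⟩
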